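/- Let $m,n$ be coprime positive integers and let $G=G_{m,n}=\langle x,y\mid x^m=y^n\rangle$ be the group of the torus knot of type $(m,n)$. The character of a representation $\rho:G\to \mathrm{SL}(2,\mathbb C)$ is the function $\chi_\rho(g)=\operatorname{tr}\rho(g)$, and $X(G)$ is the set of all these characters, with the structure of an affine variety for which the regular functions are the polynomials in the trace functions $\chi\mapsto\chi(g)$, $g\in G$. A representation is reducible if all the matrices $\rho(g)$ share a common eigenvector, and irreducible otherwise. Let $\Psi:X(G)\to\mathbb C^3$, $\Psi(\chi)=(\chi(x),\chi(y),\chi(xy))$; that is, $\Psi$ sends the character of $x\mapsto A$, $y\mapsto B$ to $(\operatorname{tr}A,\operatorname{tr}B,\operatorname{tr}AB)$. Then: 1. The image $C=\Psi(X(G))\subset\mathbb C^3$ is an algebraic curve, and $\Psi:X(G)\to C$ is an isomorphism of affine varieties. 2. $C$ has exactly $\frac{(m-1)(n-1)}2+1$ irreducible components. Each of them is smooth and isomorphic, as an algebraic variety, to $\mathbb C$. 3. Any point common to two different components of $C$ is a nodal normal crossing: exactly two components pass through it, both are nonsingular there, their tangent lines are different, and the tangent space of $C$ there is the plane spanned by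 these two lines. 4. One component is $C_{red}$, the image under $\Psi$ of the set of characters of reducible representations. The other components are the pairwise disjoint, distinct lines $$L_{k,k'}=\{(\lambda+\lambda^{-1},\ \mu+\mu^{-1},\ z)\mid z\in\mathbb C\},\qquad \lambda=e^{\pi i k/m},\ \mu=e^{\pi i k'/n},$$ for the integers $0<k<m$, $0<k'<n$ with $k\equiv k' \pmod 2$. The union of these lines is the Zariski closure of the image of the set of characters of irreducible representations. 5. Each line $L_{k,k'}$ meets $C_{red}$ in exactly two points. They are the points $$\left(t^n+t^{-n},\ t^m+t^{-m},\ t^{n+m}+t^{-(n+m)}\right),\qquad t=e^{\pi i l/(mn)},$$ for the integers $0<l<mn$ with $l\equiv\pm k \pmod{2m}$ and $l\equiv\pm k'\pmod{2n}$ (the two signs being independent of each other). -/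

import Mathlib

namespace TorusKnotChar

open MvPolynomial

/-! ### Affine algebraic sets over the complex numbers -/

/-- The affine space `ℂ^d`. -/
abbrev Aff (d : ℕ) : Type := Fin d → ℂ

/-- Algebraic (that is, Zariski closed) subsets of `ℂ^d`. -/
def IsAlgebraicSet {d : ℕ} (Z : Set (Aff d)) : Prop :=
  ∃ I : Ideal (MvPolynomial (Fin d) ℂ), Z = zeroLocus ℂ I

/-- The Zariski closure of a subset of `ℂ^d`. -/
def zariskiClosure {d : ℕ} (S : Set (Aff d)) : Set (Aff d) :=
  zeroLocus ℂ (vanishingIdeal ℂ S)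

/-- Irreducible algebraic sets: nonempty, and not the union of two proper algebraic subsets. -/
def IsIrreducibleAlgebraicSet {d : ℕ} (Z : Set (Aff d)) : Prop :=
  IsAlgebraicSet Z ∧ Z.Nonempty ∧
    ∀ Z₁ Z₂ : Set (Aff d), IsAlgebraicSet Z₁ → IsAlgebraicSet Z₂ →
      Z ⊆ Z₁ ∪ Z₂ → Z ⊆ Z₁ ∨ Z ⊆ Z₂

/-- The irreducible components of `C`: the maximal irreducible algebraic subsets of `C`. -/
def components {d : ℕ} (C : Set (Aff d)) : Set (Set (Aff d)) :=
  {Z | Maximal (fun Y => IsIrreducibleAlgebraicSet Y ∧ Y ⊆ C) Z}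

/-- The ring of regular functions of an algebraic set `Z ⊆ ℂ^d`: the functions on `Z` that
are polynomials in the coordinates. -/
def regularFunctions {d : ℕ} (Z : Set (Aff d)) : Subalgebra ℂ (Z → ℂ) :=
  Algebra.adjoin ℂ (Set.range fun (i : Fin d) (p : Z) => (p : Aff d) i)

/-- The ring of regular functions of the affine line `ℂ`: the polynomial functions. -/
def lineFunctions : Subalgebra ℂ (ℂ → ℂ) :=
  Algebra.adjoin ℂ {(id : ℂ → ℂ)}

/-- An isomorphism of affine varieties, each given as a set of points with its ring of regular
functions: a bijection such that `φ` and its inverse both pull back regular functions to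
regular functions. -/
def IsIsomorphism {V W : Type*} (A : Subalgebra ℂ (V → ℂ)) (B : Subalgebra ℂ (W → ℂ))
    (φ : V → W) : Prop :=
  Function.Bijective φ ∧ ∀ h : W → ℂ, h ∈ B ↔ h ∘ φ ∈ A

/-- The (Krull) dimension of an algebraic set. -/
noncomputable def dimension {d : ℕ} (Z : Set (Aff d)) : WithBot ℕ∞ :=
  ringKrullDim (regularFunctions Z)

/-- An algebraic curve: a nonempty algebraic set, all of whose irreducible components have
dimension one. -/
def IsCurve {d : ℕ} (C : Set (Aff d)) : Prop :=
  IsAlgebraicSet C ∧ C.Nonempty ∧ ∀ Z ∈ components C, dimension Z = 1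

/-- The differential at `p` of a polynomial. -/
noncomputable def differential {d : ℕ} (f : MvPolynomial (Fin d) ℂ) (p : Aff d) :
    Aff d →ₗ[ℂ] ℂ :=
  ∑ i, eval p (pderiv i f) • LinearMap.proj i

/-- The Zariski tangent space at `p` of an algebraic set `Z ⊆ ℂ^d`: the common kernel of the
differentials of all polynomials that vanish on `Z`. -/
noncomputable def tangentSpace {d : ℕ} (Z : Set (Aff d)) (p : Aff d) : Submodule ℂ (Aff d) :=
  ⨅ f ∈ vanishingIdeal ℂ Z, LinearMap.ker (differential f p)

/-- Smoothness of an irreducible algebraic set: the tangent space at every point has the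
dimension of the set. -/
def IsSmooth {d : ℕ} (Z : Set (Aff d)) : Prop :=
  ∀ p ∈ Z, (Module.finrank ℂ (tangentSpace Z p) : WithBot ℕ∞) = dimension Z

/-- The curve `C` has at `p` a nodal normal crossing of two components: exactly two components
pass through `p`, both are nonsingular at `p`, their tangent lines are different, and the
tangent space of `C` at `p` is the plane spanned by these two lines. -/
def IsNodalCrossing {d : ℕ} (C : Set (Aff d)) (p : Aff d) : Prop :=
  ∃ Z₁ ∈ components C, ∃ Z₂ ∈ components C, Z₁ ≠ Z₂ ∧
    (∀ Z ∈ components C, p ∈ Z ↔ Z = Z₁ ∨ Z = Z₂) ∧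
    Module.finrank ℂ (tangentSpace Z₁ p) = 1 ∧
    Module.finrank ℂ (tangentSpace Z₂ p) = 1 ∧
    tangentSpace Z₁ p ⊓ tangentSpace Z₂ p = ⊥ ∧
    tangentSpace Z₁ p ⊔ tangentSpace Z₂ p = tangentSpace C p

/-! ### Characters of representations into `SL(2,ℂ)` -/

/-- The group `SL(2,ℂ)`. -/
abbrev SL2 : Type := Matrix.SpecialLinearGroup (Fin 2) ℂ

/-- The character of a representation. -/
def character {G : Type*} [Group G] (ρ : G →* SL2) : G → ℂ :=
  fun g => (ρ g : Matrix (Fin 2) (Fin 2) ℂ).trace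

/-- A representation is reducible if all its matrices share a common eigenvector. -/
def IsReducible {G : Type*} [Group G] (ρ : G →* SL2) : Prop :=
  ∃ v : Fin 2 → ℂ, v ≠ 0 ∧
    ∀ g : G, ∃ c : ℂ, (ρ g : Matrix (Fin 2) (Fin 2) ℂ).mulVec v = c • v

/-- The points of the character variety `X(G)`: the characters of all representations. -/
def CharVariety (G : Type*) [Group G] : Type _ :=
  {χ : G → ℂ // ∃ ρ : G →* SL2, character ρ = χ}

/-- The ring of regular functions of the character variety: the functions on `X(G)` that are
polynomials in the trace functions `χ ↦ χ g`, `g ∈ G`. -/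
def charFunctions (G : Type*) [Group G] : Subalgebra ℂ (CharVariety G → ℂ) :=
  Algebra.adjoin ℂ (Set.range fun (g : G) (χ : CharVariety G) => χ.1 g)

/-- The set of the characters of reducible representations. -/
def reducibleCharacters (G : Type*) [Group G] : Set (CharVariety G) :=
  {χ | ∃ ρ : G →* SL2, IsReducible ρ ∧ character ρ = χ.1}

/-- The set of the characters of irreducible representations. -/
def irreducibleCharacters (G : Type*) [Group G] : Set (CharVariety G) :=
  {χ | ∃ ρ : G →* SL2, ¬ IsReducible ρ ∧ character ρ = χ.1}

/-! ### Torus knot groups -/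

/-- The group of the torus knot of type `(m,n)`: `⟨x, y | x^m = y^n⟩`. -/
abbrev TorusKnotGroup (m n : ℕ) : Type :=
  PresentedGroup
    ({FreeGroup.of 0 ^ m * (FreeGroup.of 1 ^ n)⁻¹} : Set (FreeGroup (Fin 2)))

/-- The generator `x`. -/
def genX (m n : ℕ) : TorusKnotGroup m n := PresentedGroup.of 0

/-- The generator `y`. -/
def genY (m n : ℕ) : TorusKnotGroup m n := PresentedGroup.of 1

/-- The trace map `Ψ`, which sends the character of the representation `x ↦ A`, `y ↦ B` to
`(tr A, tr B, tr AB)`. -/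
def traceMap (m n : ℕ) (χ : CharVariety (TorusKnotGroup m n)) : Aff 3 :=
  ![χ.1 (genX m n), χ.1 (genY m n), χ.1 (genX m n * genY m n)]

/-- The image `C` of the trace map. -/
def traceImage (m n : ℕ) : Set (Aff 3) := Set.range (traceMap m n)

/-- The image of the reducible characters. -/
def redComponent (m n : ℕ) : Set (Aff 3) :=
  traceMap m n '' reducibleCharacters (TorusKnotGroup m n)

/-- The index set of the irreducible lines: `0 < k < m`, `0 < k' < n`, `k ≡ k' mod 2`. -/
def lineIndex (m n : ℕ) : Set (ℕ × ℕ) :=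
  {q | (0 < q.1 ∧ q.1 < m) ∧ (0 < q.2 ∧ q.2 < n) ∧ q.1 ≡ q.2 [MOD 2]}

/-- The line in `ℂ³` with direction `(0,0,1)` on which `tr A = λ + λ⁻¹` and `tr B = μ + μ⁻¹`,
where `λ = exp(π i k / m)` and `μ = exp(π i k' / n)`. -/
def irrLine (m n : ℕ) (q : ℕ × ℕ) : Set (Aff 3) :=
  {p | p 0 = Complex.exp (Real.pi * Complex.I * q.1 / m)
          + (Complex.exp (Real.pi * Complex.I * q.1 / m))⁻¹ ∧
       p 1 = Complex.exp (Real.pi * Complex.I * q.2 / n)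
          + (Complex.exp (Real.pi * Complex.I * q.2 / n))⁻¹}

/-- The image under `Ψ` of the character of the diagonal representation
`A = diag(t^n, t^(-n))`, `B = diag(t^m, t^(-m))`. -/
noncomputable def diagPoint (m n : ℕ) (t : ℂ) : Aff 3 :=
  ![t ^ n + (t ^ n)⁻¹, t ^ m + (t ^ m)⁻¹, t ^ (n + m) + (t ^ (n + m))⁻¹]

/-- The numbers `l` of the points at which the line with index `q = (k, k')` meets the
reducible component: `0 < l < mn`, `l ≡ ±k mod 2m`, `l ≡ ±k' mod 2n`. -/
def crossingIndex (m n : ℕ) (q : ℕ × ℕ) : Set ℕ :=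
  {l | (0 < l ∧ l < m * n) ∧
    ((l : ℤ) ≡ q.1 [ZMOD 2 * m] ∨ (l : ℤ) ≡ -q.1 [ZMOD 2 * m]) ∧
    ((l : ℤ) ≡ q.2 [ZMOD 2 * n] ∨ (l : ℤ) ≡ -q.2 [ZMOD 2 * n])}

/-- The point of the reducible component with parameter `t = exp(π i l / (mn))`. -/
noncomputable def crossingPoint (m n l : ℕ) : Aff 3 :=
  diagPoint m n (Complex.exp (Real.pi * Complex.I * l / (m * n)))

end TorusKnotChar

namespace TorusKnotChar

open MvPolynomial

/-! ### Algebraic sets -/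

/-! Write `A`, `B` for the images of `x`, `y`. By the Cayley–Hamilton identity and its polarization,
every word in `A`, `B` is a combination of `1`, `A`, `B`, `AB` whose coefficients are polynomials in
`tr A`, `tr B`, `tr AB` (`exists_word_coordinates`). So the three traces generate all trace
functions, and Ψ is an isomorphism onto its image.

If `A`, `B` share an eigenvector with eigenvalues `a`, `b`, then `a^m = b^n`, and coprimality gives
`a = t^n`, `b = t^m` for some `t`. The reducible locus is therefore the curve of Chebyshev
polynomials in `s = t + t⁻¹` (`redComponent_eq_range`). Moreover `s` is the trace of a word, hence a
polynomial in the coordinates (`exists_redCurve_parameter`).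

If the representation is irreducible, Schur's lemma makes the central element `x^m = y^n` a scalar,
necessarily ±1, while `A` and `B` are not scalar. Their eigenvalues are then roots of unity other
than ±1, and equality of the two signs is the parity condition
(`exists_mem_irrLine_of_irreducible`). Conversely `tr AB` may be chosen freely
(`irrLine_subset_traceImage`).

Thus `C` is a finite union of polynomially embedded lines, each with a polynomial `F` in the
coordinates that recovers its parameter. This alone gives closedness, irreducibility, smoothness and
the isomorphism with ℂ. The lines over different pairs of traces are disjoint, and the Chinese
remainder theorem shows that each meets the reducible curve twice. There the reducible curve is not
vertical, because the eigenvalue of `A` is not ±1; one explicit equation then bounds the tangent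
space of `C` by a plane (`tangentSpace_crossing`). -/

theorem isAlgebraicSet_iff {d : ℕ} {Z : Set (Aff d)} :
    IsAlgebraicSet Z ↔ ∀ p, (∀ f ∈ vanishingIdeal ℂ Z, eval p f = 0) → p ∈ Z := by
  constructor
  · rintro ⟨I, rfl⟩ p hp
    rw [mem_zeroLocus_iff]
    intro f hf
    rw [aeval_eq_eval]
    exact hp f (le_vanishingIdeal_zeroLocus I hf)
  · intro h
    refine ⟨vanishingIdeal ℂ Z, Set.Subset.antisymm (zeroLocus_vanishingIdeal_le Z) ?_⟩
    intro p hp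
    exact h p fun f hf => by simpa [aeval_eq_eval] using hp f hf

theorem mem_vanishingIdeal_iff_eval {d : ℕ} {Z : Set (Aff d)} {f : MvPolynomial (Fin d) ℂ} :
    f ∈ vanishingIdeal ℂ Z ↔ ∀ p ∈ Z, eval p f = 0 := by
  simp [mem_vanishingIdeal_iff, aeval_eq_eval]

theorem IsAlgebraicSet.exists_separating {d : ℕ} {Z : Set (Aff d)} (hZ : IsAlgebraicSet Z)
    {p : Aff d} (hp : p ∉ Z) : ∃ f, (∀ q ∈ Z, eval q f = 0) ∧ eval p f ≠ 0 := by
  by_contra! h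
  exact hp (isAlgebraicSet_iff.1 hZ p fun f hf => h f (mem_vanishingIdeal_iff_eval.1 hf))

theorem isAlgebraicSet_of_separating {d : ℕ} {Z : Set (Aff d)}
    (h : ∀ p ∉ Z, ∃ f, (∀ q ∈ Z, eval q f = 0) ∧ eval p f ≠ 0) : IsAlgebraicSet Z := by
  rw [isAlgebraicSet_iff]
  intro p hp
  by_contra hpZ
  obtain ⟨f, hf, hfp⟩ := h p hpZ
  exact hfp (hp f (mem_vanishingIdeal_iff_eval.2 hf))

theorem IsAlgebraicSet.union {d : ℕ} {Z W : Set (Aff d)} (hZ : IsAlgebraicSet Z)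
    (hW : IsAlgebraicSet W) : IsAlgebraicSet (Z ∪ W) := by
  refine isAlgebraicSet_of_separating fun p hp => ?_
  obtain ⟨f, hf, hfp⟩ := hZ.exists_separating fun h => hp (Or.inl h)
  obtain ⟨g, hg, hgp⟩ := hW.exists_separating fun h => hp (Or.inr h)
  refine ⟨f * g, ?_, by simp [hfp, hgp]⟩
  rintro q (hq | hq)
  · simp [hf q hq]
  · simp [hg q hq]

theorem isAlgebraicSet_empty {d : ℕ} : IsAlgebraicSet (∅ : Set (Aff d)) :=
  isAlgebraicSet_of_separating fun _ _ => ⟨1, by simp, by simp⟩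

theorem isAlgebraicSet_sUnion {d : ℕ} {S : Set (Set (Aff d))} (hS : S.Finite)
    (h : ∀ Z ∈ S, IsAlgebraicSet Z) : IsAlgebraicSet (⋃₀ S) := by
  induction S, hS using Set.Finite.induction_on with
  | empty => simpa using isAlgebraicSet_empty
  | insert _ _ ih =>
    rw [Set.sUnion_insert]
    exact (h _ (Set.mem_insert _ _)).union (ih fun Z hZ => h Z (Set.mem_insert_of_mem _ hZ))

theorem IsIrreducibleAlgebraicSet.subset_of_subset_sUnion {d : ℕ} {Y : Set (Aff d)}
    (hY : IsIrreducibleAlgebraicSet Y) {S : Set (Set (Aff d))} (hS : S.Finite)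
    (h : ∀ Z ∈ S, IsAlgebraicSet Z) (hYS : Y ⊆ ⋃₀ S) : ∃ Z ∈ S, Y ⊆ Z := by
  induction S, hS using Set.Finite.induction_on with
  | empty =>
    obtain ⟨p, hp⟩ := hY.2.1
    simpa using hYS hp
  | @insert Z S _ hS ih =>
    have hS' : ∀ Z ∈ S, IsAlgebraicSet Z := fun Z hZ => h Z (Set.mem_insert_of_mem _ hZ)
    rw [Set.sUnion_insert] at hYS
    rcases hY.2.2 _ _ (h _ (Set.mem_insert _ _)) (isAlgebraicSet_sUnion hS hS') hYS with h1 | h1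
    · exact ⟨Z, Set.mem_insert _ _, h1⟩
    · obtain ⟨W, hW, hYW⟩ := ih hS' h1
      exact ⟨W, Set.mem_insert_of_mem _ hW, hYW⟩

/-- An irreducible subset of a finite union of closed sets lies in one of them, so only members of
`S` can be maximal; the antichain hypothesis makes all of them maximal. -/
theorem components_sUnion {d : ℕ} {S : Set (Set (Aff d))} (hS : S.Finite)
    (hirr : ∀ Z ∈ S, IsIrreducibleAlgebraicSet Z) (hanti : ∀ Z ∈ S, ∀ W ∈ S, Z ⊆ W → Z = W) :
    components (⋃₀ S) = S := by
  have hsub : ∀ Y, IsIrreducibleAlgebraicSet Y → Y ⊆ ⋃₀ S → ∃ Z ∈ S, Y ⊆ Z := fun Y hY h =>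
    hY.subset_of_subset_sUnion hS (fun Z hZ => (hirr Z hZ).1) h
  ext Z
  constructor
  · rintro ⟨⟨hZ, hZS⟩, hmax⟩
    obtain ⟨W, hW, hZW⟩ := hsub Z hZ hZS
    have := hmax ⟨hirr W hW, Set.subset_sUnion_of_mem hW⟩ hZW
    rwa [Set.Subset.antisymm hZW this]
  · intro hZ
    refine ⟨⟨hirr Z hZ, Set.subset_sUnion_of_mem hZ⟩, ?_⟩
    rintro Y ⟨hY, hYS⟩ hZY
    obtain ⟨W, hW, hYW⟩ := hsub Y hY hYS
    have := hanti Z hZ W hW (hZY.trans hYW)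
    rw [this]
    exact hYW

/-! ### Isomorphisms and dimension -/

theorem IsIsomorphism.ringKrullDim_eq {V W : Type*} {A : Subalgebra ℂ (V → ℂ)}
    {B : Subalgebra ℂ (W → ℂ)} {φ : V → W} (h : IsIsomorphism A B φ) :
    ringKrullDim A = ringKrullDim B := by
  let F : B →+* A :=
    { toFun := fun b => ⟨b.1 ∘ φ, (h.2 b.1).1 b.2⟩
      map_one' := rfl
      map_mul' := fun _ _ => rfl
      map_zero' := rfl
      map_add' := fun _ _ => rfl }
  refine (ringKrullDim_eq_of_ringEquiv (RingEquiv.ofBijective F ⟨?_, ?_⟩)).symm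
  · intro b c hbc
    apply Subtype.ext
    exact h.1.2.injective_comp_right (congrArg Subtype.val hbc)
  · intro a
    obtain ⟨ψ, hψ, hψ'⟩ := Function.bijective_iff_has_inverse.1 h.1
    have e : (a.1 ∘ ψ) ∘ φ = a.1 := by
      funext v
      simp [hψ v]
    refine ⟨⟨a.1 ∘ ψ, (h.2 _).2 ?_⟩, Subtype.ext e⟩
    rw [e]
    exact a.2

/-- Pullback along `φ` is an algebra homomorphism, so both directions need checking on generators
only. -/
theorem isIsomorphism_adjoin {V W ι κ : Type*} {f : ι → V → ℂ} {g : κ → W → ℂ} {φ : V → W}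
    (hφ : Function.Bijective φ) (hg : ∀ k, g k ∘ φ ∈ Algebra.adjoin ℂ (Set.range f))
    (hf : ∀ i, ∃ h ∈ Algebra.adjoin ℂ (Set.range g), h ∘ φ = f i) :
    IsIsomorphism (Algebra.adjoin ℂ (Set.range f)) (Algebra.adjoin ℂ (Set.range g)) φ := by
  let F : (W → ℂ) →ₐ[ℂ] (V → ℂ) :=
    { toFun := fun b => b ∘ φ
      map_one' := rfl
      map_mul' := fun _ _ => rfl
      map_zero' := rfl
      map_add' := fun _ _ => rfl
      commutes' := fun _ => rfl }
  have h1 : Algebra.adjoin ℂ (Set.range g) ≤ (Algebra.adjoin ℂ (Set.range f)).comap F := by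
    rw [Algebra.adjoin_le_iff]
    rintro _ ⟨k, rfl⟩
    exact hg k
  have h2 : Algebra.adjoin ℂ (Set.range f) ≤ (Algebra.adjoin ℂ (Set.range g)).map F := by
    rw [Algebra.adjoin_le_iff]
    rintro _ ⟨i, rfl⟩
    obtain ⟨h, hh, hh'⟩ := hf i
    exact ⟨h, hh, hh'⟩
  refine ⟨hφ, fun h => ⟨fun hh => h1 hh, fun hh => ?_⟩⟩
  obtain ⟨h', hh', e⟩ := h2 hh
  have : h' = h := hφ.2.injective_comp_right e
  rwa [← this]

theorem eval_mem_regularFunctions {d : ℕ} (Z : Set (Aff d)) (f : MvPolynomial (Fin d) ℂ) :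
    (fun p : Z => eval (p : Aff d) f) ∈ regularFunctions Z := by
  induction f using MvPolynomial.induction_on with
  | C a =>
    simp only [eval_C]
    exact (regularFunctions Z).algebraMap_mem a
  | add f g hf hg =>
    simp only [map_add]
    exact (regularFunctions Z).add_mem hf hg
  | mul_X f i hf =>
    simp only [map_mul, eval_X]
    exact (regularFunctions Z).mul_mem hf (Algebra.subset_adjoin ⟨i, rfl⟩)

/-- Over the infinite field ℂ a polynomial is determined by its function, so this ring is a copy of
`ℂ[X]`. -/
theorem ringKrullDim_lineFunctions : ringKrullDim lineFunctions = 1 := by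
  have hinj : Function.Injective (Polynomial.aeval (R := ℂ) (id : ℂ → ℂ)) := by
    intro p q h
    apply Polynomial.funext
    intro r
    have := congrFun h r
    simpa [Polynomial.aeval_fn_apply] using this
  have e := AlgEquiv.ofInjective _ hinj
  have : lineFunctions = (Polynomial.aeval (R := ℂ) (id : ℂ → ℂ)).range :=
    Algebra.adjoin_singleton_eq_range_aeval _ _
  rw [this, ← ringKrullDim_eq_of_ringEquiv e.toRingEquiv, Polynomial.ringKrullDim_of_isNoetherianRing,
    ringKrullDim_eq_zero_of_field, zero_add]

theorem eval_mem_lineFunctions (f : Polynomial ℂ) : (fun s => f.eval s) ∈ lineFunctions := by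
  have : (fun s => f.eval s) = Polynomial.aeval (R := ℂ) (id : ℂ → ℂ) f := by
    funext s
    simp [Polynomial.aeval_fn_apply]
  rw [this]
  exact Polynomial.aeval_mem_adjoin_singleton _ _

/-! ### Differentials and tangent spaces -/

theorem differential_apply {d : ℕ} (f : MvPolynomial (Fin d) ℂ) (p w : Aff d) :
    differential f p w = ∑ i, eval p (pderiv i f) * w i := by
  simp [differential]

theorem differential_sub {d : ℕ} (f g : MvPolynomial (Fin d) ℂ) (p w : Aff d) :
    differential (f - g) p w = differential f p w - differential g p w := by
  simp [differential_apply, sub_mul, Finset.sum_sub_distrib]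

theorem differential_mul {d : ℕ} (f g : MvPolynomial (Fin d) ℂ) (p w : Aff d) :
    differential (f * g) p w = eval p f * differential g p w + eval p g * differential f p w := by
  simp [differential_apply, Finset.mul_sum, ← Finset.sum_add_distrib]
  exact Finset.sum_congr rfl fun i _ => by ring

theorem differential_X {d : ℕ} (i : Fin d) (p w : Aff d) :
    differential (X i) p w = w i := by
  simp [differential_apply, pderiv_X, Pi.single_apply, apply_ite]

theorem differential_C {d : ℕ} (a : ℂ) (p w : Aff d) :
    differential (C a) p w = 0 := by
  simp [differential_apply]

theorem eval_aeval_polynomial {d : ℕ} (f : Polynomial ℂ) (G : MvPolynomial (Fin d) ℂ) (p : Aff d) :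
    eval p (Polynomial.aeval G f) = f.eval (eval p G) := by
  induction f using Polynomial.induction_on' with
  | add f g hf hg => simp [hf, hg]
  | monomial n a => simp [Polynomial.aeval_monomial, algebraMap_eq]

theorem differential_aeval {d : ℕ} (f : Polynomial ℂ) (F : MvPolynomial (Fin d) ℂ) (p w : Aff d) :
    differential (Polynomial.aeval F f) p w =
      f.derivative.eval (eval p F) * differential F p w := by
  simp only [differential_apply, Derivation.map_aeval, smul_eq_mul, map_mul, Finset.mul_sum]
  refine Finset.sum_congr rfl fun i _ => ?_
  rw [eval_aeval_polynomial, mul_assoc]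

theorem mem_tangentSpace {d : ℕ} {Z : Set (Aff d)} {p w : Aff d} :
    w ∈ tangentSpace Z p ↔ ∀ f, (∀ q ∈ Z, eval q f = 0) → differential f p w = 0 := by
  simp [tangentSpace, Submodule.mem_iInf, aeval_eq_eval]

theorem tangentSpace_mono {d : ℕ} {Z W : Set (Aff d)} (h : Z ⊆ W) (p : Aff d) :
    tangentSpace Z p ≤ tangentSpace W p := by
  intro w hw
  rw [mem_tangentSpace] at hw ⊢
  exact fun f hf => hw f fun q hq => hf q (h hq)

/-! ### Polynomially embedded lines -/

/-- The point with parameter `s` on the curve with coordinate polynomials `γ`. -/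
noncomputable def curvePoint {d : ℕ} (γ : Fin d → Polynomial ℂ) (s : ℂ) : Aff d :=
  fun i => (γ i).eval s

/-- The velocity at the parameter `s` of the curve with coordinate polynomials `γ`. -/
noncomputable def curveVelocity {d : ℕ} (γ : Fin d → Polynomial ℂ) (s : ℂ) : Aff d :=
  fun i => (γ i).derivative.eval s

theorem eval_curvePoint {d : ℕ} (γ : Fin d → Polynomial ℂ) (s : ℂ) (f : MvPolynomial (Fin d) ℂ) :
    eval (curvePoint γ s) f = (aeval γ f).eval s := by
  induction f using MvPolynomial.induction_on with
  | C a => simp [Polynomial.algebraMap_eq]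
  | add f g hf hg => simp [hf, hg]
  | mul_X f i hf => simp [hf, curvePoint]

/-- The chain rule along the curve. -/
theorem differential_curvePoint {d : ℕ} (γ : Fin d → Polynomial ℂ) (s : ℂ)
    (f : MvPolynomial (Fin d) ℂ) :
    differential f (curvePoint γ s) (curveVelocity γ s) = (aeval γ f).derivative.eval s := by
  induction f using MvPolynomial.induction_on with
  | C a => simp [differential_C, Polynomial.algebraMap_eq]
  | add f g hf hg =>
    simp only [differential_apply] at hf hg ⊢
    simp [add_mul, Finset.sum_add_distrib, hf, hg]
  | mul_X f i hf =>
    rw [differential_mul, hf, differential_X, eval_curvePoint]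
    simp [curveVelocity, curvePoint]
    ring

theorem eval_curvePoint_eq_zero {d : ℕ} {γ : Fin d → Polynomial ℂ} {f : MvPolynomial (Fin d) ℂ}
    (h : ∀ q ∈ Set.range (curvePoint γ), eval q f = 0) : aeval γ f = 0 := by
  apply Polynomial.funext
  intro s
  rw [← eval_curvePoint, h _ ⟨s, rfl⟩, Polynomial.eval_zero]

section EmbeddedLine

variable {d : ℕ} {γ : Fin d → Polynomial ℂ} {F : MvPolynomial (Fin d) ℂ}

theorem eval_parameter (hF : aeval γ F = Polynomial.X) (s : ℂ) : eval (curvePoint γ s) F = s := by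
  rw [eval_curvePoint, hF, Polynomial.eval_X]

theorem curvePoint_injective (hF : aeval γ F = Polynomial.X) :
    Function.Injective (curvePoint γ) := fun s t h => by
  rw [← eval_parameter hF s, h, eval_parameter hF]

theorem infinite_range_curvePoint (hF : aeval γ F = Polynomial.X) :
    (Set.range (curvePoint γ)).Infinite :=
  Set.infinite_range_of_injective (curvePoint_injective hF)

/-- The equations `X i = γ i (F)` cut out the curve: a point `p` that satisfies them is the curve
point with parameter `F(p)`. -/
theorem isAlgebraicSet_range_curvePoint (hF : aeval γ F = Polynomial.X) :
    IsAlgebraicSet (Set.range (curvePoint γ)) := by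
  refine isAlgebraicSet_of_separating fun p hp => ?_
  by_contra! h
  refine hp ⟨eval p F, funext fun i => ?_⟩
  have := h (X i - Polynomial.aeval F (γ i)) ?_
  · rw [map_sub, eval_X, eval_aeval_polynomial, sub_eq_zero] at this
    exact this.symm
  · rintro _ ⟨s, rfl⟩
    rw [map_sub, eval_X, eval_aeval_polynomial, eval_parameter hF, curvePoint, sub_self]

/-- Restriction to the curve maps polynomials into the domain `ℂ[X]`, where a product of two nonzero
restrictions cannot vanish. -/
theorem isIrreducible_range_curvePoint (hF : aeval γ F = Polynomial.X) :
    IsIrreducibleAlgebraicSet (Set.range (curvePoint γ)) := by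
  refine ⟨isAlgebraicSet_range_curvePoint hF, Set.range_nonempty _, ?_⟩
  intro Z₁ Z₂ h₁ h₂ h
  by_contra! hn
  obtain ⟨p₁, ⟨s₁, rfl⟩, hp₁⟩ := Set.not_subset.1 hn.1
  obtain ⟨p₂, ⟨s₂, rfl⟩, hp₂⟩ := Set.not_subset.1 hn.2
  obtain ⟨f₁, hf₁, hf₁'⟩ := h₁.exists_separating hp₁
  obtain ⟨f₂, hf₂, hf₂'⟩ := h₂.exists_separating hp₂
  have : aeval γ (f₁ * f₂) = 0 := by
    refine eval_curvePoint_eq_zero fun q hq => ?_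
    rcases h hq with hq | hq
    · simp [hf₁ q hq]
    · simp [hf₂ q hq]
  rw [eval_curvePoint] at hf₁' hf₂'
  rw [map_mul, mul_eq_zero] at this
  rcases this with h | h
  · exact hf₁' (by rw [h, Polynomial.eval_zero])
  · exact hf₂' (by rw [h, Polynomial.eval_zero])

theorem isIsomorphism_parameter (hF : aeval γ F = Polynomial.X) :
    IsIsomorphism (regularFunctions (Set.range (curvePoint γ))) lineFunctions
      (fun p => eval (p : Aff d) F) := by
  have hl : lineFunctions = Algebra.adjoin ℂ (Set.range fun _ : Unit => (id : ℂ → ℂ)) := by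
    simp [lineFunctions]
  have hγ : ∀ p : Set.range (curvePoint γ), curvePoint γ (eval (p : Aff d) F) = p := by
    rintro ⟨_, s, rfl⟩
    rw [eval_parameter hF]
  rw [hl]
  refine isIsomorphism_adjoin ⟨?_, ?_⟩ ?_ ?_
  · intro p q h
    apply Subtype.ext
    rw [← hγ p, ← hγ q]
    exact congrArg _ h
  · exact fun s => ⟨⟨_, s, rfl⟩, eval_parameter hF s⟩
  · exact fun _ => eval_mem_regularFunctions _ F
  · intro i
    refine ⟨_, hl ▸ eval_mem_lineFunctions (γ i), ?_⟩
    funext p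
    exact congrFun (hγ p) i

theorem dimension_range_curvePoint (hF : aeval γ F = Polynomial.X) :
    dimension (Set.range (curvePoint γ)) = 1 :=
  (isIsomorphism_parameter hF).ringKrullDim_eq.trans ringKrullDim_lineFunctions

theorem differential_parameter (hF : aeval γ F = Polynomial.X) (s : ℂ) :
    differential F (curvePoint γ s) (curveVelocity γ s) = 1 := by
  rw [differential_curvePoint, hF, Polynomial.derivative_X, Polynomial.eval_one]

theorem curveVelocity_ne_zero (hF : aeval γ F = Polynomial.X) (s : ℂ) : curveVelocity γ s ≠ 0 := by
  intro h
  have := differential_parameter hF s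
  rw [h, map_zero] at this
  exact zero_ne_one this

/-- The differentials of the equations `X i = γ i (F)` force a tangent vector to be `dF(w)` times
the velocity; the chain rule gives the converse. -/
theorem tangentSpace_range_curvePoint (hF : aeval γ F = Polynomial.X) (s : ℂ) :
    tangentSpace (Set.range (curvePoint γ)) (curvePoint γ s) =
      Submodule.span ℂ {curveVelocity γ s} := by
  apply le_antisymm
  · intro w hw
    rw [Submodule.mem_span_singleton]
    refine ⟨differential F (curvePoint γ s) w, funext fun i => ?_⟩
    have := mem_tangentSpace.1 hw (X i - Polynomial.aeval F (γ i)) (by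
      rintro _ ⟨s, rfl⟩
      rw [map_sub, eval_X, eval_aeval_polynomial, eval_parameter hF, curvePoint, sub_self])
    rw [differential_sub, differential_X, differential_aeval, eval_parameter hF, sub_eq_zero] at this
    rw [this, Pi.smul_apply, smul_eq_mul, curveVelocity, mul_comm]
  · rw [Submodule.span_singleton_le_iff_mem, mem_tangentSpace]
    intro f hf
    rw [differential_curvePoint, eval_curvePoint_eq_zero hf, Polynomial.derivative_zero,
      Polynomial.eval_zero]

theorem finrank_tangentSpace_range_curvePoint (hF : aeval γ F = Polynomial.X) (s : ℂ) :
    Module.finrank ℂ (tangentSpace (Set.range (curvePoint γ)) (curvePoint γ s)) = 1 := by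
  rw [tangentSpace_range_curvePoint hF, finrank_span_singleton (curveVelocity_ne_zero hF s)]

theorem isSmooth_range_curvePoint (hF : aeval γ F = Polynomial.X) :
    IsSmooth (Set.range (curvePoint γ)) := by
  rintro _ ⟨s, rfl⟩
  rw [finrank_tangentSpace_range_curvePoint hF, dimension_range_curvePoint hF]
  rfl

end EmbeddedLine

/-! ### Vertical lines -/

/-- The coordinate polynomials of the line in `ℂ³` over the point `(a, b)` of the plane. -/
noncomputable def verticalLine (a b : ℂ) : Fin 3 → Polynomial ℂ :=
  ![Polynomial.C a, Polynomial.C b, Polynomial.X]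

theorem aeval_verticalLine (a b : ℂ) :
    aeval (verticalLine a b) (X 2 : MvPolynomial (Fin 3) ℂ) = Polynomial.X := by
  simp [verticalLine]

theorem curveVelocity_verticalLine (a b s : ℂ) :
    curveVelocity (verticalLine a b) s = ![0, 0, 1] := by
  funext i
  fin_cases i <;> simp [curveVelocity, verticalLine]

theorem range_verticalLine (a b : ℂ) :
    Set.range (curvePoint (verticalLine a b)) = {p | p 0 = a ∧ p 1 = b} := by
  ext p
  constructor
  · rintro ⟨s, rfl⟩
    simp [curvePoint, verticalLine]
  · rintro ⟨h0, h1⟩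
    refine ⟨p 2, funext fun i => ?_⟩
    fin_cases i <;> simp [curvePoint, verticalLine, h0, h1]

/-- The tangent space at a transversal intersection of a vertical line with an embedded line. -/
theorem tangentSpace_crossing {γ : Fin 3 → Polynomial ℂ} {F : MvPolynomial (Fin 3) ℂ}
    (hF : aeval γ F = Polynomial.X) {a b s : ℂ} (ha : (γ 0).eval s = a) (hb : (γ 1).eval s = b)
    (hv : (γ 0).derivative.eval s ≠ 0) {W : Set (Aff 3)} (hW : IsAlgebraicSet W)
    (hp : curvePoint γ s ∉ W) :
    tangentSpace (Set.range (curvePoint (verticalLine a b)) ∪ Set.range (curvePoint γ) ∪ W)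
      (curvePoint γ s) ≤ Submodule.span ℂ {![0, 0, 1]} ⊔ Submodule.span ℂ {curveVelocity γ s} := by
  intro w hw
  rw [mem_tangentSpace] at hw
  obtain ⟨g, hg, hgp⟩ := hW.exists_separating hp
  have key : ∀ (f : Polynomial ℂ) (c : ℂ), f.eval s = c →
      ∃ h : Polynomial ℂ, f - Polynomial.C c = (Polynomial.X - Polynomial.C s) * h ∧
        h.eval s = f.derivative.eval s := by
    intro f c hc
    obtain ⟨h, hh⟩ := Polynomial.dvd_iff_isRoot.2
      (show (f - Polynomial.C c).IsRoot s by simp [hc])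
    refine ⟨h, hh, ?_⟩
    have := congrArg (fun q => q.derivative.eval s) hh
    simpa using this.symm
  obtain ⟨ha', hha, hha'⟩ := key _ _ ha
  obtain ⟨hb', hhb, hhb'⟩ := key _ _ hb
  -- With `γ₀ - a = (X - s) ha'` and `γ₁ - b = (X - s) hb'`, the first factor vanishes on the
  -- vertical line, and on the curve its two terms cancel. The factor `g` handles `W` without
  -- vanishing at the point. Since `ha'(s) = γ₀'(s)` and `hb'(s) = γ₁'(s)`, the differential there
  -- is a nonzero multiple of `γ₁'(s) w₀ - γ₀'(s) w₁`, whose kernel is the required plane.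
  have h := hw (((X 0 - C a) * Polynomial.aeval F hb' - (X 1 - C b) * Polynomial.aeval F ha') * g) ?_
  · rw [differential_mul, differential_sub, differential_mul, differential_mul, differential_sub,
      differential_sub, differential_X, differential_X, differential_C, differential_C] at h
    simp only [map_mul, map_sub, eval_X, eval_C, eval_aeval_polynomial, eval_parameter hF] at h
    have h0 : curvePoint γ s 0 = a := ha
    have h1 : curvePoint γ s 1 = b := hb
    rw [h0, h1, hha', hhb'] at h
    have h' : (γ 1).derivative.eval s * w 0 = (γ 0).derivative.eval s * w 1 := by
      have : eval (curvePoint γ s) g *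
        ((γ 1).derivative.eval s * w 0 - (γ 0).derivative.eval s * w 1) = 0 := by
        linear_combination h
      rcases mul_eq_zero.1 this with h | h
      · exact absurd h hgp
      · exact sub_eq_zero.1 h
    rw [Submodule.mem_sup]
    set c := w 0 / (γ 0).derivative.eval s with hc
    refine ⟨_, Submodule.mem_span_singleton.2 ⟨w 2 - c * (γ 2).derivative.eval s, rfl⟩,
      _, Submodule.mem_span_singleton.2 ⟨c, rfl⟩, funext fun i => ?_⟩
    fin_cases i
    · simp [curveVelocity, hc, hv]
    · simp [curveVelocity, hc]
      field_simp
      linear_combination h'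
    · simp [curveVelocity]
  · rintro q ((⟨z, rfl⟩ | ⟨r, rfl⟩) | hq)
    · simp [curvePoint, verticalLine]
    · simp only [map_mul, map_sub, eval_X, eval_C, eval_aeval_polynomial, eval_parameter hF]
      have h0 := congrArg (Polynomial.eval r) hha
      have h1 := congrArg (Polynomial.eval r) hhb
      simp only [Polynomial.eval_sub, Polynomial.eval_mul, Polynomial.eval_C,
        Polynomial.eval_X] at h0 h1
      have : curvePoint γ r 0 = (γ 0).eval r := rfl
      have : curvePoint γ r 1 = (γ 1).eval r := rfl
      simp only [*]
      ring
    · simp [hg q hq]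

/-! ### Matrices in `SL(2,ℂ)` -/

theorem SL2.det_eq_one (A : SL2) : A.1 0 0 * A.1 1 1 - A.1 0 1 * A.1 1 0 = 1 := by
  rw [← Matrix.det_fin_two, A.2]

theorem SL2.mul_self (A : SL2) : A.1 * A.1 = A.1.trace • A.1 - 1 := by
  have h := SL2.det_eq_one A
  ext i j
  fin_cases i <;> fin_cases j <;> simp [Matrix.mul_apply, Matrix.trace_fin_two] <;>
    first | linear_combination -h | ring

theorem SL2.coe_inv_eq (A : SL2) : (A⁻¹).1 = A.1.trace • 1 - A.1 := by
  ext i j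
  fin_cases i <;> fin_cases j <;>
    simp [Matrix.SpecialLinearGroup.coe_inv, Matrix.adjugate_fin_two, Matrix.trace_fin_two]

/-- Polarized Cayley–Hamilton; it brings `BA` back into the span of `1`, `A`, `B`, `AB`. -/
theorem matrix_mul_comm_polarized (A B : Matrix (Fin 2) (Fin 2) ℂ) :
    B * A = -(A * B) + A.trace • B + B.trace • A +
      ((A * B).trace - A.trace * B.trace) • (1 : Matrix (Fin 2) (Fin 2) ℂ) := by
  ext i j
  fin_cases i <;> fin_cases j <;> simp [Matrix.mul_apply, Matrix.trace_fin_two] <;> ring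

theorem SL2.mul_mul_self (A B : SL2) :
    A.1 * B.1 * A.1 = B.1 - B.1.trace • 1 + (A.1 * B.1).trace • A.1 := by
  rw [mul_assoc, matrix_mul_comm_polarized A.1 B.1]
  simp only [mul_add, mul_neg, mul_smul_comm, ← mul_assoc, SL2.mul_self, mul_one]
  simp only [sub_mul, smul_mul_assoc, one_mul]
  module

theorem exists_eigenvector (M : Matrix (Fin 2) (Fin 2) ℂ) :
    ∃ v : Fin 2 → ℂ, v ≠ 0 ∧ ∃ c : ℂ, M.mulVec v = c • v := by
  obtain ⟨c, hc⟩ := Module.End.exists_eigenvalue (Matrix.toLin' M)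
  obtain ⟨v, hv⟩ := hc.exists_hasEigenvector
  exact ⟨v, hv.2, c, by simpa using hv.apply_eq_smul⟩

theorem SL2.trace_of_eigenvector {A : SL2} {v : Fin 2 → ℂ} (hv : v ≠ 0) {c : ℂ}
    (h : A.1.mulVec v = c • v) : c ≠ 0 ∧ A.1.trace = c + c⁻¹ := by
  have h0 := congrFun h 0
  have h1 := congrFun h 1
  simp [Matrix.mulVec, dotProduct, Fin.sum_univ_two] at h0 h1
  have hd := SL2.det_eq_one A
  have hc : c ^ 2 - A.1.trace * c + 1 = 0 := by
    rw [Matrix.trace_fin_two]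
    -- The coefficients in this and the next identity are the rows of the adjugate of `A - c`.
    have e0 : (c ^ 2 - (A.1 0 0 + A.1 1 1) * c + 1) * v 0 = 0 := by
      linear_combination (A.1 1 1 - c) * h0 - A.1 0 1 * h1 - v 0 * hd
    have e1 : (c ^ 2 - (A.1 0 0 + A.1 1 1) * c + 1) * v 1 = 0 := by
      linear_combination (A.1 0 0 - c) * h1 - A.1 1 0 * h0 - v 1 * hd
    by_contra hne
    refine hv (funext fun i => ?_)
    fin_cases i
    · exact (mul_eq_zero.1 e0).resolve_left hne
    · exact (mul_eq_zero.1 e1).resolve_left hne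
  have hc0 : c ≠ 0 := by
    rintro rfl
    simp at hc
  refine ⟨hc0, ?_⟩
  field_simp
  linear_combination -hc

theorem pow_mulVec_of_eigenvector {M : Matrix (Fin 2) (Fin 2) ℂ} {v : Fin 2 → ℂ} {c : ℂ}
    (h : M.mulVec v = c • v) (k : ℕ) : (M ^ k).mulVec v = c ^ k • v := by
  induction k with
  | zero => simp
  | succ k ih => rw [pow_succ, ← Matrix.mulVec_mulVec, h, Matrix.mulVec_smul, ih, smul_smul,
      pow_succ, mul_comm]

/-- Were `v` and `w` independent, Cramer's rule would make every row of `N` zero. -/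
theorem eq_smul_of_mulVec_eq_zero {N : Matrix (Fin 2) (Fin 2) ℂ} (hN : N ≠ 0) {v w : Fin 2 → ℂ}
    (hv : v ≠ 0) (h : N.mulVec v = 0) (h' : N.mulVec w = 0) : ∃ c : ℂ, w = c • v := by
  have hvw : v 0 * w 1 = v 1 * w 0 := by
    by_contra hne
    refine hN ?_
    have e : ∀ i, N i 0 = 0 ∧ N i 1 = 0 := by
      intro i
      have h0 := congrFun h i
      have h1 := congrFun h' i
      simp [Matrix.mulVec, dotProduct, Fin.sum_univ_two] at h0 h1
      have hne' := sub_ne_zero.2 hne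
      constructor
      · refine (mul_eq_zero.1 ?_).resolve_right hne'
        linear_combination w 1 * h0 - v 1 * h1
      · refine (mul_eq_zero.1 ?_).resolve_right hne'
        linear_combination v 0 * h1 - w 0 * h0
    ext i j
    fin_cases j
    · exact (e i).1
    · exact (e i).2
  by_cases h0 : v 0 = 0
  · have h1 : v 1 ≠ 0 := fun h1 => hv (funext fun i => by fin_cases i <;> assumption)
    refine ⟨w 1 / v 1, funext fun i => ?_⟩
    rw [h0, zero_mul] at hvw
    fin_cases i
    · simp [h0, (mul_eq_zero.1 hvw.symm).resolve_left h1]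
    · simp [h1]
  · refine ⟨w 0 / v 0, funext fun i => ?_⟩
    fin_cases i
    · simp [h0]
    · simp
      field_simp
      linear_combination hvw

/-- The powers of a matrix in `SL(2,ℂ)` whose eigenvalues are `u` and `u⁻¹`. -/
theorem SL2.pow_eq {A : SL2} {u : ℂ} (hu : u ≠ 0) (hA : A.1.trace = u + u⁻¹) (k : ℕ) :
    (u - u⁻¹) • A.1 ^ (k + 1) =
      (u ^ (k + 1) - u⁻¹ ^ (k + 1)) • A.1 - (u ^ k - u⁻¹ ^ k) • 1 := by
  induction k with
  | zero => simp
  | succ k ih =>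
    rw [pow_succ, ← smul_mul_assoc, ih, sub_mul, smul_mul_assoc, SL2.mul_self, hA, smul_mul_assoc,
      one_mul]
    have : u * u⁻¹ = 1 := mul_inv_cancel₀ hu
    have e : (u ^ (k + 1 + 1) - u⁻¹ ^ (k + 1 + 1)) =
        (u ^ (k + 1) - u⁻¹ ^ (k + 1)) * (u + u⁻¹) - (u ^ k - u⁻¹ ^ k) := by
      linear_combination (u⁻¹ ^ k - u ^ k) * this
    rw [e]
    module

/-- The limiting case of `SL2.pow_eq`, where division by `u - u⁻¹` is impossible. -/
theorem SL2.pow_eq_of_parabolic {A : SL2} {u : ℂ} (hu : u ^ 2 = 1) (hA : A.1.trace = 2 * u)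
    (k : ℕ) : A.1 ^ (k + 1) = ((k + 1) * u ^ k) • A.1 - (k * u ^ (k + 1)) • 1 := by
  induction k with
  | zero => simp
  | succ k ih =>
    rw [pow_succ, ih, sub_mul, smul_mul_assoc, SL2.mul_self, hA, smul_mul_assoc, one_mul]
    have e : (k + 1) * u ^ k = (k + 1) * u ^ (k + 1 + 1) := by
      linear_combination -(k + 1) * u ^ k * hu
    push_cast
    rw [show (k + 1) * u ^ (k + 1 + 1) = (k + 1) * u ^ k from e.symm]
    module

/-- Here `u^m` and `u⁻¹^m` both equal the sign `ε`, so the coefficient of `A` in `SL2.pow_eq`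
vanishes. -/
theorem SL2.pow_eq_smul_one {A : SL2} {u ε : ℂ} (hA : A.1.trace = u + u⁻¹) (hu : u ^ 2 ≠ 1)
    (hu0 : u ≠ 0) (hε : ε ^ 2 = 1) {m : ℕ} (hm : 0 < m) (hum : u ^ m = ε) :
    A.1 ^ m = ε • 1 := by
  obtain ⟨k, rfl⟩ := Nat.exists_eq_succ_of_ne_zero hm.ne'
  have h := SL2.pow_eq hu0 hA k
  have hε' : ε⁻¹ = ε := by
    apply inv_eq_of_mul_eq_one_left
    rw [← hε, sq]
  have hne : u - u⁻¹ ≠ 0 := by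
    intro h
    apply hu
    have := mul_inv_cancel₀ hu0
    linear_combination u * h + this
  have huk : u ^ k = ε * u⁻¹ := by
    rw [← hum, Nat.succ_eq_add_one, pow_succ, mul_assoc, mul_inv_cancel₀ hu0, mul_one]
  have huk' : u⁻¹ ^ k = ε * u := by
    rw [inv_pow, huk, mul_inv, hε', inv_inv]
  have e : u⁻¹ ^ (k + 1) = ε := by
    rw [inv_pow, ← Nat.succ_eq_add_one, hum, hε']
  rw [e, ← Nat.succ_eq_add_one, hum, sub_self, zero_smul, huk, huk'] at h
  apply smul_right_injective _ hne
  simp only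
  rw [h]
  module

/-! ### Traces of words -/

/-- The traces `(tr ρ(x), tr ρ(y), tr ρ(xy))`. -/
noncomputable def tracePoint {G : Type*} [Group G] (x y : G) (ρ : G →* SL2) : Aff 3 :=
  ![(ρ x).1.trace, (ρ y).1.trace, ((ρ x).1 * (ρ y).1).trace]

/-- The span of `1`, `A`, `B`, `AB` is stable under right multiplication by `A` and `B`, hence by
`A⁻¹ = tr A - A` and `B⁻¹ = tr B - B`. Induction on the word gives coefficients that do not depend
on `ρ`. -/
theorem exists_word_coordinates {G : Type*} [Group G] {x y : G}
    (hxy : Subgroup.closure {x, y} = ⊤) (g : G) :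
    ∃ p₀ p₁ p₂ p₃ : MvPolynomial (Fin 3) ℂ, ∀ ρ : G →* SL2,
      (ρ g).1 = eval (tracePoint x y ρ) p₀ • 1 + eval (tracePoint x y ρ) p₁ • (ρ x).1 +
        eval (tracePoint x y ρ) p₂ • (ρ y).1 +
        eval (tracePoint x y ρ) p₃ • ((ρ x).1 * (ρ y).1) := by
  have hx : ∀ (p₀ p₁ p₂ p₃ : ℂ) (A B : SL2),
      (p₀ • 1 + p₁ • A.1 + p₂ • B.1 + p₃ • (A.1 * B.1)) * A.1 =
        (-p₁ + ((A.1 * B.1).trace - A.1.trace * B.1.trace) * p₂ - B.1.trace * p₃) • 1 +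
        (p₀ + A.1.trace * p₁ + B.1.trace * p₂ + (A.1 * B.1).trace * p₃) • A.1 +
        (A.1.trace * p₂ + p₃) • B.1 + (-p₂) • (A.1 * B.1) := by
    intro p₀ p₁ p₂ p₃ A B
    simp only [add_mul, smul_mul_assoc, one_mul, SL2.mul_self, SL2.mul_mul_self]
    rw [matrix_mul_comm_polarized A.1 B.1]
    module
  have hy : ∀ (p₀ p₁ p₂ p₃ : ℂ) (A B : SL2),
      (p₀ • 1 + p₁ • A.1 + p₂ • B.1 + p₃ • (A.1 * B.1)) * B.1 =
        (-p₂) • 1 + (-p₃) • A.1 + (p₀ + B.1.trace * p₂) • B.1 +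
        (p₁ + B.1.trace * p₃) • (A.1 * B.1) := by
    intro p₀ p₁ p₂ p₃ A B
    simp only [add_mul, smul_mul_assoc, one_mul, SL2.mul_self, mul_assoc, mul_sub, mul_smul_comm,
      mul_one]
    module
  have hg : g ∈ Subgroup.closure {x, y} := hxy ▸ Subgroup.mem_top g
  induction hg using Subgroup.closure_induction_right with
  | one => exact ⟨1, 0, 0, 0, fun ρ => by simp⟩
  | mul_right g _ z hz ih =>
    obtain ⟨p₀, p₁, p₂, p₃, h⟩ := ih
    rcases hz with rfl | hz
    · refine ⟨-p₁ + (X 2 - X 0 * X 1) * p₂ - X 1 * p₃, p₀ + X 0 * p₁ + X 1 * p₂ + X 2 * p₃,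
        X 0 * p₂ + p₃, -p₂, fun ρ => ?_⟩
      rw [map_mul, Matrix.SpecialLinearGroup.coe_mul, h, hx]
      simp [tracePoint]
    · rw [Set.mem_singleton_iff] at hz
      subst hz
      refine ⟨-p₂, -p₃, p₀ + X 1 * p₂, p₁ + X 1 * p₃, fun ρ => ?_⟩
      rw [map_mul, Matrix.SpecialLinearGroup.coe_mul, h, hy]
      simp [tracePoint]
  | mul_inv_cancel g _ z hz ih =>
    obtain ⟨p₀, p₁, p₂, p₃, h⟩ := ih
    rcases hz with rfl | hz
    · refine ⟨X 0 * p₀ - (-p₁ + (X 2 - X 0 * X 1) * p₂ - X 1 * p₃),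
        X 0 * p₁ - (p₀ + X 0 * p₁ + X 1 * p₂ + X 2 * p₃),
        X 0 * p₂ - (X 0 * p₂ + p₃), X 0 * p₃ - -p₂, fun ρ => ?_⟩
      rw [map_mul, map_inv, Matrix.SpecialLinearGroup.coe_mul, SL2.coe_inv_eq, mul_sub,
        mul_smul_comm, mul_one, h, hx]
      simp [tracePoint]
      module
    · rw [Set.mem_singleton_iff] at hz
      subst hz
      refine ⟨X 1 * p₀ - -p₂, X 1 * p₁ - -p₃, X 1 * p₂ - (p₀ + X 1 * p₂),
        X 1 * p₃ - (p₁ + X 1 * p₃), fun ρ => ?_⟩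
      rw [map_mul, map_inv, Matrix.SpecialLinearGroup.coe_mul, SL2.coe_inv_eq, mul_sub,
        mul_smul_comm, mul_one, h, hy]
      simp [tracePoint]
      module

/-- The trace of a word is a polynomial in the traces of `x`, `y` and `xy`. -/
theorem exists_trace_polynomial {G : Type*} [Group G] {x y : G}
    (hxy : Subgroup.closure {x, y} = ⊤) (g : G) :
    ∃ P : MvPolynomial (Fin 3) ℂ, ∀ ρ : G →* SL2,
      character ρ g = eval (tracePoint x y ρ) P := by
  obtain ⟨p₀, p₁, p₂, p₃, h⟩ := exists_word_coordinates hxy g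
  refine ⟨2 * p₀ + X 0 * p₁ + X 1 * p₂ + X 2 * p₃, fun ρ => ?_⟩
  rw [character, h]
  simp [tracePoint, Matrix.trace_add, Matrix.trace_smul]
  ring

/-! ### Irreducible representations -/

/-- Schur's lemma: an eigenspace of `ρ z` is invariant under the group, and if it were only a line
it would give a common eigenvector. -/
theorem exists_eq_smul_one_of_commute {G : Type*} [Group G] {ρ : G →* SL2} (hρ : ¬ IsReducible ρ)
    {z : G} (hz : ∀ g, Commute z g) : ∃ c : ℂ, (ρ z).1 = c • 1 := by
  obtain ⟨v, hv, c, hc⟩ := exists_eigenvector (ρ z).1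
  refine ⟨c, ?_⟩
  by_contra hne
  refine hρ ⟨v, hv, fun g => ?_⟩
  have hN : ∀ w, ((ρ z).1 - c • 1).mulVec w = (ρ z).1.mulVec w - c • w := fun w => by
    rw [Matrix.sub_mulVec, Matrix.smul_mulVec, Matrix.one_mulVec]
  refine eq_smul_of_mulVec_eq_zero (sub_ne_zero.2 hne) hv ?_ ?_
  · rw [hN, hc, sub_self]
  · have : (ρ z).1 * (ρ g).1 = (ρ g).1 * (ρ z).1 := by
      rw [← Matrix.SpecialLinearGroup.coe_mul, ← Matrix.SpecialLinearGroup.coe_mul, ← map_mul,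
        ← map_mul, (hz g).eq]
    rw [hN, Matrix.mulVec_mulVec, this, ← Matrix.mulVec_mulVec, hc, Matrix.mulVec_smul, sub_self]

theorem isReducible_of_common_eigenvector {G : Type*} [Group G] {x y : G}
    (hxy : Subgroup.closure {x, y} = ⊤) {ρ : G →* SL2} {v : Fin 2 → ℂ} (hv : v ≠ 0)
    (hx : ∃ c : ℂ, (ρ x).1.mulVec v = c • v) (hy : ∃ c : ℂ, (ρ y).1.mulVec v = c • v) :
    IsReducible ρ := by
  refine ⟨v, hv, fun g => ?_⟩
  have hg : g ∈ Subgroup.closure {x, y} := hxy ▸ Subgroup.mem_top g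
  induction hg using Subgroup.closure_induction with
  | mem z hz =>
    rcases hz with rfl | hz
    · exact hx
    · rw [Set.mem_singleton_iff] at hz
      exact hz ▸ hy
  | one => exact ⟨1, by simp⟩
  | mul g h _ _ ihg ihh =>
    obtain ⟨c, hc⟩ := ihg
    obtain ⟨d, hd⟩ := ihh
    exact ⟨d * c, by rw [map_mul, Matrix.SpecialLinearGroup.coe_mul, ← Matrix.mulVec_mulVec, hd,
      Matrix.mulVec_smul, hc, smul_smul]⟩
  | inv g _ ih =>
    obtain ⟨c, hc⟩ := ih
    refine ⟨(ρ g).1.trace - c, ?_⟩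
    rw [map_inv, SL2.coe_inv_eq, Matrix.sub_mulVec, Matrix.smul_mulVec, Matrix.one_mulVec, hc,
      sub_smul]

/-! ### Representations of torus knot groups -/

variable {m n : ℕ}

theorem closure_gens (m n : ℕ) : Subgroup.closure {genX m n, genY m n} = ⊤ := by
  rw [← PresentedGroup.closure_range_of]
  congr 1
  ext g
  simp [Fin.exists_fin_two, genX, genY, eq_comm]

theorem genX_pow_eq (m n : ℕ) : genX m n ^ m = genY m n ^ n := by
  have := PresentedGroup.mk_eq_mk_of_mul_inv_mem
    (rels := ({FreeGroup.of 0 ^ m * (FreeGroup.of 1 ^ n)⁻¹} : Set (FreeGroup (Fin 2))))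
    (Set.mem_singleton (FreeGroup.of 0 ^ m * (FreeGroup.of 1 ^ n)⁻¹))
  rwa [map_pow, map_pow] at this

theorem exists_hom {H : Type*} [Group H] {a b : H} (h : a ^ m = b ^ n) :
    ∃ ρ : TorusKnotGroup m n →* H, ρ (genX m n) = a ∧ ρ (genY m n) = b := by
  refine ⟨PresentedGroup.toGroup (f := ![a, b]) ?_, ?_, ?_⟩
  · rintro r rfl
    simp [h]
  · rw [genX, PresentedGroup.toGroup.of]
    rfl
  · rw [genY, PresentedGroup.toGroup.of]
    rfl

theorem traceMap_character (ρ : TorusKnotGroup m n →* SL2) :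
    traceMap m n ⟨character ρ, ρ, rfl⟩ = tracePoint (genX m n) (genY m n) ρ := by
  simp [traceMap, tracePoint, character]

theorem traceMap_eq_tracePoint {ρ : TorusKnotGroup m n →* SL2}
    {χ : CharVariety (TorusKnotGroup m n)} (h : character ρ = χ.1) :
    traceMap m n χ = tracePoint (genX m n) (genY m n) ρ := by
  rw [← traceMap_character]
  exact congrArg _ (Subtype.ext h.symm)

theorem mem_traceImage {p : Aff 3} : p ∈ traceImage m n ↔
    ∃ ρ : TorusKnotGroup m n →* SL2, tracePoint (genX m n) (genY m n) ρ = p := by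
  constructor
  · rintro ⟨⟨χ, ρ, h⟩, rfl⟩
    exact ⟨ρ, (traceMap_eq_tracePoint h).symm⟩
  · rintro ⟨ρ, rfl⟩
    exact ⟨_, traceMap_character ρ⟩

theorem mem_redComponent {p : Aff 3} : p ∈ redComponent m n ↔
    ∃ ρ : TorusKnotGroup m n →* SL2, IsReducible ρ ∧
      tracePoint (genX m n) (genY m n) ρ = p := by
  constructor
  · rintro ⟨χ, ⟨ρ, hρ, h⟩, rfl⟩
    exact ⟨ρ, hρ, (traceMap_eq_tracePoint h).symm⟩
  · rintro ⟨ρ, hρ, rfl⟩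
    exact ⟨_, ⟨ρ, hρ, rfl⟩, traceMap_character ρ⟩

theorem mem_image_irreducibleCharacters {p : Aff 3} :
    p ∈ traceMap m n '' irreducibleCharacters (TorusKnotGroup m n) ↔
    ∃ ρ : TorusKnotGroup m n →* SL2, ¬ IsReducible ρ ∧
      tracePoint (genX m n) (genY m n) ρ = p := by
  constructor
  · rintro ⟨χ, ⟨ρ, hρ, h⟩, rfl⟩
    exact ⟨ρ, hρ, (traceMap_eq_tracePoint h).symm⟩
  · rintro ⟨ρ, hρ, rfl⟩
    exact ⟨_, ⟨ρ, hρ, rfl⟩, traceMap_character ρ⟩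

theorem isIsomorphism_traceMap (m n : ℕ) :
    IsIsomorphism (charFunctions (TorusKnotGroup m n)) (regularFunctions (traceImage m n))
      (Set.rangeFactorization (traceMap m n)) := by
  have key : ∀ g, ∃ P : MvPolynomial (Fin 3) ℂ, ∀ χ : CharVariety (TorusKnotGroup m n),
      χ.1 g = eval (traceMap m n χ) P := by
    intro g
    obtain ⟨P, hP⟩ := exists_trace_polynomial (closure_gens m n) g
    refine ⟨P, ?_⟩
    rintro ⟨_, ρ, rfl⟩
    rw [traceMap_character, ← hP]
  refine isIsomorphism_adjoin (f := fun g (χ : CharVariety (TorusKnotGroup m n)) => χ.1 g)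
    (g := fun i (p : traceImage m n) => (p : Aff 3) i) ⟨?_, Set.rangeFactorization_surjective⟩ ?_ ?_
  · intro χ χ' h
    have h' : traceMap m n χ = traceMap m n χ' := congrArg Subtype.val h
    refine Subtype.ext (funext fun g => ?_)
    obtain ⟨P, hP⟩ := key g
    rw [hP, hP, h']
  · intro i
    fin_cases i
    · exact Algebra.subset_adjoin ⟨genX m n, rfl⟩
    · exact Algebra.subset_adjoin ⟨genY m n, rfl⟩
    · exact Algebra.subset_adjoin ⟨genX m n * genY m n, rfl⟩
  · intro g
    obtain ⟨P, hP⟩ := key g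
    refine ⟨fun p => eval (p : Aff 3) P, eval_mem_regularFunctions _ P, ?_⟩
    funext χ
    change eval (traceMap m n χ) P = χ.1 g
    exact (hP χ).symm

/-! ### Reducible representations -/

/-- The embedding of the diagonal torus. -/
noncomputable def diagHom : ℂˣ →* SL2 where
  toFun u := ⟨!![(u : ℂ), 0; 0, ((u⁻¹ : ℂˣ) : ℂ)], by simp [Matrix.det_fin_two]⟩
  map_one' := by
    apply Subtype.ext
    simp [Matrix.one_fin_two]
  map_mul' u v := by
    apply Subtype.ext
    change _ = !![(u : ℂ), 0; 0, ((u⁻¹ : ℂˣ) : ℂ)] * !![(v : ℂ), 0; 0, ((v⁻¹ : ℂˣ) : ℂ)]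
    simp [mul_comm]

theorem coe_diagHom (u : ℂˣ) : (diagHom u).1 = !![(u : ℂ), 0; 0, (u : ℂ)⁻¹] := by
  rw [← Units.val_inv_eq_inv_val]
  rfl

theorem exists_diagonal_representation (m n : ℕ) {t : ℂ} (ht : t ≠ 0) :
    ∃ σ : TorusKnotGroup m n →* ℂˣ, (σ (genX m n) : ℂ) = t ^ n ∧ (σ (genY m n) : ℂ) = t ^ m ∧
      IsReducible (diagHom.comp σ) ∧
      tracePoint (genX m n) (genY m n) (diagHom.comp σ) = diagPoint m n t := by
  obtain ⟨σ, h1, h2⟩ := exists_hom (m := m) (n := n) (a := Units.mk0 t ht ^ n)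
    (b := Units.mk0 t ht ^ m) (by rw [← pow_mul, ← pow_mul, mul_comm])
  refine ⟨σ, by simp [h1], by simp [h2], ⟨![1, 0], ?_, fun g => ⟨σ g, ?_⟩⟩, ?_⟩
  · intro h
    simpa using congrFun h 0
  · rw [MonoidHom.comp_apply, coe_diagHom]
    ext i
    fin_cases i <;> simp [Matrix.mulVec, dotProduct, Fin.sum_univ_two]
  · simp only [tracePoint, MonoidHom.comp_apply, coe_diagHom, h1, h2, diagPoint]
    simp [Matrix.trace_fin_two, pow_add, mul_comm]

theorem mem_redComponent_iff (hmn : Nat.Coprime m n) {p : Aff 3} :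
    p ∈ redComponent m n ↔ ∃ t : ℂ, t ≠ 0 ∧ diagPoint m n t = p := by
  rw [mem_redComponent]
  constructor
  · rintro ⟨ρ, ⟨v, hv, h⟩, rfl⟩
    obtain ⟨a, ha⟩ := h (genX m n)
    obtain ⟨b, hb⟩ := h (genY m n)
    obtain ⟨ha0, hta⟩ := SL2.trace_of_eigenvector hv ha
    obtain ⟨hb0, htb⟩ := SL2.trace_of_eigenvector hv hb
    have hab : (ρ (genX m n * genY m n)).1.mulVec v = (a * b) • v := by
      rw [map_mul, Matrix.SpecialLinearGroup.coe_mul, ← Matrix.mulVec_mulVec, hb,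
        Matrix.mulVec_smul, ha, smul_smul, mul_comm]
    obtain ⟨-, htab⟩ := SL2.trace_of_eigenvector hv hab
    have hpow : a ^ m = b ^ n := by
      have e : (ρ (genX m n)).1 ^ m = (ρ (genY m n)).1 ^ n := by
        rw [← Matrix.SpecialLinearGroup.coe_pow, ← Matrix.SpecialLinearGroup.coe_pow, ← map_pow,
          ← map_pow, genX_pow_eq]
      have h1 := pow_mulVec_of_eigenvector ha m
      rw [e, pow_mulVec_of_eigenvector hb n] at h1
      exact (smul_left_injective ℂ hv h1).symm
    have hbez : (m : ℤ) * m.gcdA n + n * m.gcdB n = 1 := by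
      rw [← Nat.gcd_eq_gcd_ab, hmn, Nat.cast_one]
    have hzpow : a ^ (m : ℤ) = b ^ (n : ℤ) := by exact_mod_cast hpow
    -- With `m u + n v = 1`, the common root is `t = a^v b^u`: the relation `a^m = b^n` gives `t^n =
    -- a^(n v + m u) = a`, and likewise `t^m = b`.
    have h1 : (a ^ m.gcdB n * b ^ m.gcdA n) ^ n = a := by
      rw [← zpow_natCast, mul_zpow, ← zpow_mul, ← zpow_mul, mul_comm _ (n : ℤ), mul_comm _ (n : ℤ),
        zpow_mul b, ← hzpow, ← zpow_mul, ← zpow_add₀ ha0, add_comm, hbez, zpow_one]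
    have h2 : (a ^ m.gcdB n * b ^ m.gcdA n) ^ m = b := by
      rw [← zpow_natCast, mul_zpow, ← zpow_mul, ← zpow_mul, mul_comm _ (m : ℤ), mul_comm _ (m : ℤ),
        zpow_mul a, hzpow, ← zpow_mul, ← zpow_add₀ hb0, add_comm, hbez, zpow_one]
    refine ⟨a ^ m.gcdB n * b ^ m.gcdA n, mul_ne_zero (zpow_ne_zero _ ha0) (zpow_ne_zero _ hb0), ?_⟩
    rw [diagPoint, pow_add, h1, h2, tracePoint, hta, htb, ← htab, map_mul,
      Matrix.SpecialLinearGroup.coe_mul]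
  · rintro ⟨t, ht, rfl⟩
    obtain ⟨σ, -, -, h1, h2⟩ := exists_diagonal_representation m n ht
    exact ⟨_, h1, h2⟩

/-! ### The reducible component as an embedded line -/

theorem exists_add_inv_eq (s : ℂ) : ∃ t : ℂ, t ≠ 0 ∧ t + t⁻¹ = s := by
  obtain ⟨r, hr⟩ := IsAlgClosed.exists_pow_nat_eq (s ^ 2 - 4) (n := 2) (by norm_num)
  have h : (s + r) / 2 * ((s - r) / 2) = 1 := by linear_combination -hr / 4
  refine ⟨(s + r) / 2, left_ne_zero_of_mul_eq_one h, ?_⟩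
  rw [inv_eq_of_mul_eq_one_right h]
  ring

theorem add_inv_eq_add_inv {u w : ℂ} (hu : u ≠ 0) (hw : w ≠ 0) :
    u + u⁻¹ = w + w⁻¹ ↔ u = w ∨ u = w⁻¹ := by
  constructor
  · intro h
    have : (u - w) * (u * w - 1) = 0 := by
      field_simp at h
      linear_combination h
    rcases mul_eq_zero.1 this with h | h
    · exact Or.inl (sub_eq_zero.1 h)
    · exact Or.inr (eq_inv_of_mul_eq_one_left (sub_eq_zero.1 h))
  · rintro (rfl | rfl)
    · rfl
    · rw [inv_inv, add_comm]

theorem eval_chebyshev_C {t : ℂ} (ht : t ≠ 0) (k : ℕ) :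
    (Polynomial.Chebyshev.C ℂ k).eval (t + t⁻¹) = t ^ k + (t ^ k)⁻¹ := by
  induction k using Nat.twoStepInduction with
  | zero => simp; norm_num
  | one => simp
  | more k ih1 ih2 =>
    push_cast at ih2 ⊢
    rw [Polynomial.Chebyshev.C_add_two, Polynomial.eval_sub, Polynomial.eval_mul, ih1, ih2,
      Polynomial.eval_X]
    field_simp
    ring

/-- This is `eval_chebyshev_C` differentiated in `t` and multiplied by `t`. -/
theorem derivative_chebyshev_C {t : ℂ} (ht : t ≠ 0) (k : ℕ) :
    (Polynomial.Chebyshev.C ℂ k).derivative.eval (t + t⁻¹) * (t - t⁻¹) =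
      k * (t ^ k - (t ^ k)⁻¹) := by
  induction k using Nat.twoStepInduction with
  | zero => simp
  | one => simp
  | more k ih1 ih2 =>
    have hC := eval_chebyshev_C ht (k + 1)
    push_cast at hC ih2 ⊢
    rw [Polynomial.Chebyshev.C_add_two, Polynomial.derivative_sub, Polynomial.derivative_mul,
      Polynomial.derivative_X, Polynomial.eval_sub, Polynomial.eval_add, Polynomial.eval_mul,
      Polynomial.eval_mul, Polynomial.eval_one, Polynomial.eval_X, sub_mul, ih1, add_mul, hC,
      mul_assoc (t + t⁻¹), ih2]
    field_simp
    ring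

/-- The coordinate polynomials of the reducible component in the parameter `t + t⁻¹`. -/
noncomputable def redCurve (m n : ℕ) : Fin 3 → Polynomial ℂ :=
  ![Polynomial.Chebyshev.C ℂ n, Polynomial.Chebyshev.C ℂ m,
    Polynomial.Chebyshev.C ℂ ((n + m : ℕ) : ℤ)]

theorem curvePoint_redCurve (m n : ℕ) {t : ℂ} (ht : t ≠ 0) :
    curvePoint (redCurve m n) (t + t⁻¹) = diagPoint m n t := by
  funext i
  fin_cases i
  · exact eval_chebyshev_C ht n
  · exact eval_chebyshev_C ht m
  · exact eval_chebyshev_C ht (n + m)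

theorem redComponent_eq_range (hmn : Nat.Coprime m n) :
    redComponent m n = Set.range (curvePoint (redCurve m n)) := by
  ext p
  rw [mem_redComponent_iff hmn]
  constructor
  · rintro ⟨t, ht, rfl⟩
    exact ⟨_, curvePoint_redCurve m n ht⟩
  · rintro ⟨s, rfl⟩
    obtain ⟨t, ht, rfl⟩ := exists_add_inv_eq s
    exact ⟨t, ht, (curvePoint_redCurve m n ht).symm⟩

/-- The parameter of the reducible component is the trace of an element that maps to a generator
of the abelianization. -/
theorem exists_redCurve_parameter (hmn : Nat.Coprime m n) :
    ∃ F : MvPolynomial (Fin 3) ℂ, aeval (redCurve m n) F = Polynomial.X := by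
  obtain ⟨F, hF⟩ := exists_trace_polynomial (closure_gens m n)
    (genX m n ^ m.gcdB n * genY m n ^ m.gcdA n)
  refine ⟨F, Polynomial.funext fun s => ?_⟩
  obtain ⟨t, ht, rfl⟩ := exists_add_inv_eq s
  obtain ⟨σ, h1, h2, -, h4⟩ := exists_diagonal_representation m n ht
  have h := hF (diagHom.comp σ)
  have hbez : (m : ℤ) * m.gcdA n + n * m.gcdB n = 1 := by
    rw [← Nat.gcd_eq_gcd_ab, hmn, Nat.cast_one]
  have e : (σ (genX m n ^ m.gcdB n * genY m n ^ m.gcdA n) : ℂ) = t := by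
    rw [map_mul, map_zpow, map_zpow, Units.val_mul, Units.val_zpow_eq_zpow_val,
      Units.val_zpow_eq_zpow_val, h1, h2, ← zpow_natCast, ← zpow_natCast, ← zpow_mul, ← zpow_mul,
      ← zpow_add₀ ht, add_comm, hbez, zpow_one]
  rw [h4, character, MonoidHom.comp_apply, coe_diagHom, e] at h
  rw [← eval_curvePoint, curvePoint_redCurve m n ht, ← h]
  simp [Matrix.trace_fin_two]

/-! ### Roots of unity -/

/-- The number `exp(π i k / m)`. -/
noncomputable def halfTurn (m : ℕ) (k : ℤ) : ℂ := Complex.exp (Real.pi * Complex.I * k / m)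

theorem halfTurn_ne_zero (m : ℕ) (k : ℤ) : halfTurn m k ≠ 0 := Complex.exp_ne_zero _

theorem halfTurn_neg (m : ℕ) (k : ℤ) : halfTurn m (-k) = (halfTurn m k)⁻¹ := by
  rw [halfTurn, halfTurn, ← Complex.exp_neg]
  congr 1
  push_cast
  ring

theorem halfTurn_pow (m : ℕ) (k : ℤ) (j : ℕ) : halfTurn m k ^ j = halfTurn m (j * k) := by
  rw [halfTurn, halfTurn, ← Complex.exp_nat_mul]
  congr 1
  push_cast
  ring

theorem halfTurn_eq_iff {m : ℕ} (hm : 0 < m) {k l : ℤ} :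
    halfTurn m k = halfTurn m l ↔ k ≡ l [ZMOD 2 * m] := by
  have hm' : (m : ℂ) ≠ 0 := Nat.cast_ne_zero.2 hm.ne'
  have hpi : (Real.pi : ℂ) ≠ 0 := Complex.ofReal_ne_zero.2 Real.pi_ne_zero
  have hI := Complex.I_ne_zero
  rw [halfTurn, halfTurn, Complex.exp_eq_exp_iff_exists_int, Int.modEq_comm,
    Int.modEq_iff_dvd]
  refine exists_congr fun j => ?_
  rw [← Int.cast_inj (α := ℂ)]
  push_cast
  constructor
  · intro h
    field_simp at h
    linear_combination h
  · intro h
    field_simp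
    linear_combination h

theorem halfTurn_zero (m : ℕ) : halfTurn m 0 = 1 := by simp [halfTurn]

theorem halfTurn_pow_self {m : ℕ} (hm : 0 < m) (k : ℕ) : halfTurn m k ^ m = (-1) ^ k := by
  have hm' : (m : ℂ) ≠ 0 := Nat.cast_ne_zero.2 hm.ne'
  rw [halfTurn, ← Complex.exp_nat_mul, ← Complex.exp_pi_mul_I, ← Complex.exp_nat_mul]
  congr 1
  push_cast
  field_simp

theorem halfTurn_mul_pow_right {m n : ℕ} (hn : 0 < n) (l : ℤ) :
    halfTurn (m * n) l ^ n = halfTurn m l := by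
  have hn' : (n : ℂ) ≠ 0 := Nat.cast_ne_zero.2 hn.ne'
  rw [halfTurn, halfTurn, ← Complex.exp_nat_mul]
  congr 1
  push_cast
  field_simp

theorem halfTurn_mul_pow_left {m n : ℕ} (hm : 0 < m) (l : ℤ) :
    halfTurn (m * n) l ^ m = halfTurn n l := by
  rw [mul_comm, halfTurn_mul_pow_right hm]

theorem halfTurn_sq_ne_one {m k : ℕ} (hk : 0 < k) (hkm : k < m) : halfTurn m k ^ 2 ≠ 1 := by
  rw [halfTurn_pow, ← halfTurn_zero m, Ne, halfTurn_eq_iff (hk.trans hkm), Int.modEq_zero_iff_dvd]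
  intro h
  have h' : (m : ℤ) ∣ k := Int.dvd_of_mul_dvd_mul_left (by norm_num) h
  exact (Nat.le_of_dvd hk (Int.natCast_dvd_natCast.1 h')).not_gt hkm

/-- The integers from `0` to `m` represent the classes mod `2m` up to sign exactly once;
`exists_le_modEq` is the existence half. Sign changes matter because a trace determines an
eigenvalue only up to inversion. -/
theorem eq_of_modEq_or_modEq_neg {m k l : ℕ} (hk : k ≤ m) (hl : l ≤ m)
    (h : (k : ℤ) ≡ l [ZMOD 2 * m] ∨ (k : ℤ) ≡ -l [ZMOD 2 * m]) : k = l := by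
  rcases Nat.eq_zero_or_pos m with rfl | hm
  · omega
  rcases h with h | h
  · obtain ⟨c, hc⟩ := h.dvd
    have h1 : c < 1 := by
      by_contra! hc1
      nlinarith
    have h2 : -1 < c := by
      by_contra! hc1
      nlinarith
    have : c = 0 := by omega
    subst this
    omega
  · obtain ⟨c, hc⟩ := h.dvd
    have h1 : c < 1 := by
      by_contra! hc1
      nlinarith
    have h2 : -2 < c := by
      by_contra! hc1
      nlinarith
    have : c = 0 ∨ c = -1 := by omega
    rcases this with rfl | rfl <;> omega

theorem exists_le_modEq {m : ℕ} (hm : 0 < m) (a : ℤ) :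
    ∃ l : ℕ, l ≤ m ∧ (a ≡ l [ZMOD 2 * m] ∨ a ≡ -l [ZMOD 2 * m]) := by
  have h0 := Int.emod_nonneg a (b := 2 * m) (by omega)
  have h1 := Int.emod_lt_of_pos a (b := 2 * m) (by omega)
  have h2 : a % (2 * m) ≡ a [ZMOD 2 * m] := Int.mod_modEq _ _
  obtain ⟨r, hr⟩ := Int.eq_ofNat_of_zero_le h0
  rw [hr] at h1 h2
  by_cases h : r ≤ m
  · exact ⟨r, h, Or.inl h2.symm⟩
  · refine ⟨2 * m - r, by omega, Or.inr (h2.symm.trans ?_)⟩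
    rw [Int.modEq_iff_dvd]
    exact ⟨-1, by omega⟩

theorem halfTurn_add_inv_eq_iff {m : ℕ} (hm : 0 < m) {k l : ℤ} :
    halfTurn m k + (halfTurn m k)⁻¹ = halfTurn m l + (halfTurn m l)⁻¹ ↔
      k ≡ l [ZMOD 2 * m] ∨ k ≡ -l [ZMOD 2 * m] := by
  rw [add_inv_eq_add_inv (halfTurn_ne_zero _ _) (halfTurn_ne_zero _ _), ← halfTurn_neg,
    halfTurn_eq_iff hm, halfTurn_eq_iff hm]

theorem halfTurn_add_inv_injective {m k l : ℕ} (hm : 0 < m) (hk : k ≤ m) (hl : l ≤ m)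
    (h : halfTurn m k + (halfTurn m k)⁻¹ = halfTurn m l + (halfTurn m l)⁻¹) : k = l :=
  eq_of_modEq_or_modEq_neg hk hl ((halfTurn_add_inv_eq_iff hm).1 h)

theorem exists_halfTurn_of_pow_eq_one {m : ℕ} (hm : 0 < m) {w : ℂ} (hw : w ^ (2 * m) = 1) :
    ∃ l : ℕ, l ≤ m ∧ (w = halfTurn m l ∨ w = (halfTurn m l)⁻¹) := by
  have hm' : (m : ℂ) ≠ 0 := Nat.cast_ne_zero.2 hm.ne'
  have : NeZero (2 * m) := ⟨by omega⟩
  obtain ⟨j, -, hj⟩ := (Complex.isPrimitiveRoot_exp (2 * m) (by omega)).eq_pow_of_pow_eq_one hw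
  have e : halfTurn m j = w := by
    rw [← hj, halfTurn, ← Complex.exp_nat_mul]
    congr 1
    push_cast
    field_simp
  obtain ⟨l, hl, h⟩ := exists_le_modEq hm j
  refine ⟨l, hl, ?_⟩
  rwa [← halfTurn_eq_iff hm, ← halfTurn_eq_iff hm, e, halfTurn_neg] at h

/-! ### The lines of irreducible characters -/

variable {m n : ℕ}

theorem mem_irrLine {q : ℕ × ℕ} {p : Aff 3} : p ∈ irrLine m n q ↔
    p 0 = halfTurn m q.1 + (halfTurn m q.1)⁻¹ ∧ p 1 = halfTurn n q.2 + (halfTurn n q.2)⁻¹ := by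
  simp [irrLine, halfTurn]

theorem irrLine_eq_range (m n : ℕ) (q : ℕ × ℕ) : irrLine m n q = Set.range (curvePoint
    (verticalLine (halfTurn m q.1 + (halfTurn m q.1)⁻¹) (halfTurn n q.2 + (halfTurn n q.2)⁻¹))) := by
  rw [range_verticalLine]
  ext p
  exact mem_irrLine

theorem disjoint_irrLine {q q' : ℕ × ℕ} (hq : q ∈ lineIndex m n) (hq' : q' ∈ lineIndex m n)
    (h : q ≠ q') : Disjoint (irrLine m n q) (irrLine m n q') := by
  rw [Set.disjoint_left]
  intro p hp hp'
  rw [mem_irrLine] at hp hp'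
  obtain ⟨⟨-, h1⟩, ⟨-, h2⟩, -⟩ := hq
  obtain ⟨⟨-, h1'⟩, ⟨-, h2'⟩, -⟩ := hq'
  exact h (Prod.ext
    (halfTurn_add_inv_injective (by omega) h1.le h1'.le (hp.1.symm.trans hp'.1))
    (halfTurn_add_inv_injective (by omega) h2.le h2'.le (hp.2.symm.trans hp'.2)))

theorem irrLine_nonempty (m n : ℕ) (q : ℕ × ℕ) : (irrLine m n q).Nonempty := by
  rw [irrLine_eq_range]
  exact Set.range_nonempty _

theorem injOn_irrLine (m n : ℕ) : Set.InjOn (irrLine m n) (lineIndex m n) := by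
  intro q hq q' hq' h
  by_contra hne
  have := disjoint_irrLine hq hq' hne
  rw [h, disjoint_self] at this
  exact (irrLine_nonempty m n q').ne_empty this

theorem finite_lineIndex (m n : ℕ) : (lineIndex m n).Finite :=
  ((Set.finite_Iio m).prod (Set.finite_Iio n)).subset fun _ hq => ⟨hq.1.2, hq.2.1.2⟩

/-- One of `m`, `n` is odd, and reflecting that coordinate (`k ↦ m - k` or `k' ↦ n - k'`) exchanges
the pairs of equal and of opposite parity. -/
theorem ncard_lineIndex (hmn : Nat.Coprime m n) :
    (lineIndex m n).ncard = (m - 1) * (n - 1) / 2 := by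
  classical
  obtain ⟨T, hT, hmem⟩ : ∃ T : Finset (ℕ × ℕ), T.card = (m - 1) * (n - 1) ∧
      ∀ q, q ∈ T ↔ (0 < q.1 ∧ q.1 < m) ∧ (0 < q.2 ∧ q.2 < n) :=
    ⟨Finset.Ioo 0 m ×ˢ Finset.Ioo 0 n, by simp, by simp⟩
  have e : lineIndex m n = ↑(T.filter fun q => q.1 ≡ q.2 [MOD 2]) := by
    ext q
    simp [lineIndex, hmem, and_assoc]
  have hodd : m % 2 = 1 ∨ n % 2 = 1 := by
    by_contra! h
    have : 2 ∣ Nat.gcd m n := Nat.dvd_gcd (by omega) (by omega)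
    rw [hmn] at this
    omega
  have hcard : (T.filter fun q => q.1 ≡ q.2 [MOD 2]).card =
      (T.filter fun q => ¬ q.1 ≡ q.2 [MOD 2]).card := by
    rcases hodd with h | h
    · refine Finset.card_bij' (fun q _ => (m - q.1, q.2)) (fun q _ => (m - q.1, q.2)) ?_ ?_ ?_ ?_ <;>
        rintro ⟨a, b⟩ hab <;> simp only [Finset.mem_filter, hmem, Prod.mk.injEq, and_true] at hab ⊢ <;>
        simp only [Nat.ModEq] at hab ⊢ <;> omega
    · refine Finset.card_bij' (fun q _ => (q.1, n - q.2)) (fun q _ => (q.1, n - q.2)) ?_ ?_ ?_ ?_ <;>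
        rintro ⟨a, b⟩ hab <;> simp only [Finset.mem_filter, hmem, Prod.mk.injEq, true_and] at hab ⊢ <;>
        simp only [Nat.ModEq] at hab ⊢ <;> omega
  have hsum := Finset.card_filter_add_card_filter_not (s := T) fun q => q.1 ≡ q.2 [MOD 2]
  rw [e, Set.ncard_coe_finset, ← hT]
  omega

theorem SL2.trace_of_pow_eq_smul_one {A : SL2} {m : ℕ} (hm : 0 < m) {c : ℂ}
    (h : A.1 ^ m = c • 1) (hA : ∀ a : ℂ, A.1 ≠ a • 1) :
    ∃ k : ℕ, 0 < k ∧ k < m ∧ A.1.trace = halfTurn m k + (halfTurn m k)⁻¹ ∧ c = (-1) ^ k := by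
  obtain ⟨v, hv, u, hu⟩ := exists_eigenvector A.1
  obtain ⟨hu0, htr⟩ := SL2.trace_of_eigenvector hv hu
  have huc : u ^ m = c := by
    have := pow_mulVec_of_eigenvector hu m
    rw [h, Matrix.smul_mulVec, Matrix.one_mulVec] at this
    exact (smul_left_injective ℂ hv this).symm
  have hc : c ^ 2 = 1 := by
    have := congrArg Matrix.det h
    rw [Matrix.det_pow, A.2, one_pow, Matrix.det_smul, Matrix.det_one, mul_one,
      Fintype.card_fin] at this
    exact this.symm
  -- For `u = ±1` the parabolic formula expresses a nonzero multiple of `A` through scalars, against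
  -- `hA`.
  have hu2 : u ^ 2 ≠ 1 := by
    intro h2
    obtain ⟨k, rfl⟩ := Nat.exists_eq_succ_of_ne_zero hm.ne'
    have hinv : u⁻¹ = u := inv_eq_of_mul_eq_one_left (by rw [← sq, h2])
    have h3 := SL2.pow_eq_of_parabolic h2 (by rw [htr, hinv, two_mul]) k
    rw [← Nat.succ_eq_add_one, h, eq_sub_iff_add_eq, ← add_smul] at h3
    have hne : ((k : ℂ) + 1) * u ^ k ≠ 0 :=
      mul_ne_zero (Nat.cast_add_one_ne_zero k) (pow_ne_zero _ hu0)
    refine hA ((((k : ℂ) + 1) * u ^ k)⁻¹ * (c + k * u ^ k.succ)) ?_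
    rw [mul_smul, h3, smul_smul, inv_mul_cancel₀ hne, one_smul]
  obtain ⟨l, hl, hul⟩ := exists_halfTurn_of_pow_eq_one hm (w := u)
    (by rw [mul_comm, pow_mul, huc, hc])
  have hl2 : halfTurn m l ^ 2 ≠ 1 := by
    rcases hul with rfl | rfl
    · exact hu2
    · intro h
      exact hu2 (by rw [inv_pow, h, inv_one])
  have hlm : halfTurn m l ^ m = (-1) ^ l := halfTurn_pow_self hm l
  refine ⟨l, ?_, ?_, ?_, ?_⟩
  · rw [Nat.pos_iff_ne_zero]
    rintro rfl
    exact hl2 (by simp [halfTurn_zero])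
  · refine lt_of_le_of_ne hl ?_
    rintro rfl
    apply hl2
    rw [halfTurn_pow, ← halfTurn_zero l, halfTurn_eq_iff hm]
    exact Int.modEq_zero_iff_dvd.2 (by simp)
  · rw [htr, add_inv_eq_add_inv hu0 (halfTurn_ne_zero _ _)]
    exact hul
  · rw [← huc]
    rcases hul with rfl | rfl
    · exact hlm
    · rw [inv_pow, hlm, ← inv_pow, inv_neg, inv_one]

/-- The central element `x^m = y^n` acts by a scalar `c`. Neither generator is scalar, since an
eigenvector of the other would then be common; so `c = (-1)^k = (-1)^k'`. -/
theorem exists_mem_irrLine_of_irreducible (hm : 0 < m) (hn : 0 < n)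
    {ρ : TorusKnotGroup m n →* SL2} (hρ : ¬ IsReducible ρ) :
    ∃ q ∈ lineIndex m n, tracePoint (genX m n) (genY m n) ρ ∈ irrLine m n q := by
  have hxy := closure_gens m n
  have hcomm : ∀ g, Commute (genX m n ^ m) g := by
    intro g
    have hg : g ∈ Subgroup.closure {genX m n, genY m n} := hxy ▸ Subgroup.mem_top g
    induction hg using Subgroup.closure_induction with
    | mem z hz =>
      rcases hz with rfl | hz
      · exact (Commute.refl _).pow_left m
      · rw [Set.mem_singleton_iff] at hz
        rw [hz, genX_pow_eq]
        exact (Commute.refl _).pow_left n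
    | one => exact Commute.one_right _
    | mul _ _ _ _ h1 h2 => exact h1.mul_right h2
    | inv _ _ h => exact h.inv_right
  obtain ⟨c, hc⟩ := exists_eq_smul_one_of_commute hρ hcomm
  have hA : (ρ (genX m n)).1 ^ m = c • 1 := by
    rw [← hc, map_pow, Matrix.SpecialLinearGroup.coe_pow]
  have hB : (ρ (genY m n)).1 ^ n = c • 1 := by
    rw [← hc, genX_pow_eq, map_pow, Matrix.SpecialLinearGroup.coe_pow]
  have hscalar : ∀ (M : Matrix (Fin 2) (Fin 2) ℂ) (a : ℂ), M = a • 1 →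
      ∀ v : Fin 2 → ℂ, M.mulVec v = a • v := by
    rintro _ a rfl v
    rw [Matrix.smul_mulVec, Matrix.one_mulVec]
  obtain ⟨k, hk0, hkm, htA, hck⟩ := SL2.trace_of_pow_eq_smul_one hm hA fun a ha => by
    obtain ⟨v, hv, b, hb⟩ := exists_eigenvector (ρ (genY m n)).1
    exact hρ (isReducible_of_common_eigenvector hxy hv ⟨a, hscalar _ a ha v⟩ ⟨b, hb⟩)
  obtain ⟨k', hk0', hkn, htB, hck'⟩ := SL2.trace_of_pow_eq_smul_one hn hB fun a ha => by
    obtain ⟨v, hv, b, hb⟩ := exists_eigenvector (ρ (genX m n)).1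
    exact hρ (isReducible_of_common_eigenvector hxy hv ⟨b, hb⟩ ⟨a, hscalar _ a ha v⟩)
  refine ⟨(k, k'), ⟨⟨hk0, hkm⟩, ⟨hk0', hkn⟩, ?_⟩, mem_irrLine.2 ⟨htA, htB⟩⟩
  have hkk : (-1 : ℂ) ^ k = (-1) ^ k' := hck.symm.trans hck'
  change k % 2 = k' % 2
  rcases Nat.even_or_odd k with h | h <;> rcases Nat.even_or_odd k' with h' | h'
  · rw [Nat.even_iff.1 h, Nat.even_iff.1 h']
  · rw [h.neg_one_pow, h'.neg_one_pow] at hkk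
    norm_num at hkk
  · rw [h.neg_one_pow, h'.neg_one_pow] at hkk
    norm_num at hkk
  · rw [Nat.odd_iff.1 h, Nat.odd_iff.1 h']

theorem irrLine_subset_traceImage {q : ℕ × ℕ} (hq : q ∈ lineIndex m n) :
    irrLine m n q ⊆ traceImage m n := by
  intro p hp
  rw [mem_irrLine] at hp
  obtain ⟨⟨hk0, hkm⟩, ⟨hk0', hkn⟩, hpar⟩ := hq
  obtain ⟨w, hw, hwp⟩ := exists_add_inv_eq (p 2)
  have hpar' : (-1 : ℂ) ^ q.2 = (-1) ^ q.1 := by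
    rw [neg_one_pow_eq_pow_mod_two, neg_one_pow_eq_pow_mod_two (n := q.1), hpar]
  have hsq : ((-1 : ℂ) ^ q.1) ^ 2 = 1 := by
    rw [← pow_mul, mul_comm, pow_mul]
    simp
  -- These matrices have the prescribed traces, and `tr AB = w + w⁻¹ = p 2`. The powers `A^m`, `B^n`
  -- depend on the traces of `A`, `B` alone, so `p 2` is unconstrained.
  let A : SL2 := ⟨!![p 0, -1; 1, 0], by simp [Matrix.det_fin_two]⟩
  let B : SL2 := ⟨!![0, w; -w⁻¹, p 1], by simp [Matrix.det_fin_two, hw]⟩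
  have hA : A.1.trace = p 0 := by simp [A, Matrix.trace_fin_two]
  have hB : B.1.trace = p 1 := by simp [B, Matrix.trace_fin_two]
  have hAB : (A.1 * B.1).trace = p 2 := by
    rw [← hwp]
    simp [A, B, Matrix.trace_fin_two]
    ring
  have hAm := SL2.pow_eq_smul_one (hA.trans hp.1) (halfTurn_sq_ne_one hk0 hkm)
    (halfTurn_ne_zero _ _) hsq (by omega) (halfTurn_pow_self (by omega) q.1)
  have hBn := SL2.pow_eq_smul_one (hB.trans hp.2) (halfTurn_sq_ne_one hk0' hkn)
    (halfTurn_ne_zero _ _) hsq (by omega) ((halfTurn_pow_self (by omega) q.2).trans hpar')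
  obtain ⟨ρ, h1, h2⟩ := exists_hom (m := m) (n := n) (a := A) (b := B) (by
    apply Subtype.ext
    rw [Matrix.SpecialLinearGroup.coe_pow, Matrix.SpecialLinearGroup.coe_pow]
    exact hAm.trans hBn.symm)
  rw [mem_traceImage]
  refine ⟨ρ, funext fun i => ?_⟩
  rw [tracePoint, h1, h2]
  fin_cases i
  · exact hA
  · exact hB
  · exact hAB

/-! ### The crossings -/

theorem crossingPoint_eq (m n l : ℕ) :
    crossingPoint m n l = diagPoint m n (halfTurn (m * n) l) := by
  simp [crossingPoint, halfTurn]

theorem diagPoint_inv (m n : ℕ) (t : ℂ) : diagPoint m n t⁻¹ = diagPoint m n t := by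
  simp [diagPoint, add_comm]

theorem diagPoint_halfTurn_mem_irrLine (hm : 0 < m) (hn : 0 < n) {q : ℕ × ℕ} {l : ℤ} :
    diagPoint m n (halfTurn (m * n) l) ∈ irrLine m n q ↔
      (l ≡ q.1 [ZMOD 2 * m] ∨ l ≡ -q.1 [ZMOD 2 * m]) ∧
      (l ≡ q.2 [ZMOD 2 * n] ∨ l ≡ -q.2 [ZMOD 2 * n]) := by
  rw [mem_irrLine, ← halfTurn_add_inv_eq_iff hm, ← halfTurn_add_inv_eq_iff hn,
    ← halfTurn_mul_pow_right (m := m) hn l, ← halfTurn_mul_pow_left (n := n) hm l]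
  rfl

/-- This excludes the end values `l = 0` and `l = mn`, where `t = ±1`. -/
theorem not_dvd_of_modEq {m k : ℕ} (hk : 0 < k) (hkm : k < m) {l : ℤ}
    (h : l ≡ k [ZMOD 2 * m] ∨ l ≡ -k [ZMOD 2 * m]) : ¬ (m : ℤ) ∣ l := by
  intro hl
  have h' : (m : ℤ) ∣ k := by
    rcases h with h | h
    · exact (Int.dvd_iff_dvd_of_dvd_sub ((Dvd.intro_left 2 rfl).trans h.dvd)).2 hl
    · exact dvd_neg.1 ((Int.dvd_iff_dvd_of_dvd_sub ((Dvd.intro_left 2 rfl).trans h.dvd)).2 hl)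
  exact (Nat.le_of_dvd hk (Int.natCast_dvd_natCast.1 h')).not_gt hkm

theorem mem_crossingIndex {q : ℕ × ℕ} (hq : q ∈ lineIndex m n) {l : ℕ} (hl : l ≤ m * n)
    (h : ((l : ℤ) ≡ q.1 [ZMOD 2 * m] ∨ (l : ℤ) ≡ -q.1 [ZMOD 2 * m]) ∧
      ((l : ℤ) ≡ q.2 [ZMOD 2 * n] ∨ (l : ℤ) ≡ -q.2 [ZMOD 2 * n])) :
    l ∈ crossingIndex m n q := by
  have hnd := not_dvd_of_modEq hq.1.1 hq.1.2 h.1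
  refine ⟨⟨Nat.pos_of_ne_zero ?_, lt_of_le_of_ne hl ?_⟩, h⟩
  · rintro rfl
    exact hnd (by simp)
  · rintro rfl
    exact hnd (by simp)

theorem irrLine_inter_redComponent (hm : 0 < m) (hn : 0 < n) (hmn : Nat.Coprime m n) {q : ℕ × ℕ}
    (hq : q ∈ lineIndex m n) :
    irrLine m n q ∩ redComponent m n = crossingPoint m n '' crossingIndex m n q := by
  ext p
  constructor
  · rintro ⟨hp, hp'⟩
    obtain ⟨t, ht, rfl⟩ := (mem_redComponent_iff hmn).1 hp'
    have h0 : t ^ n + (t ^ n)⁻¹ = halfTurn m q.1 + (halfTurn m q.1)⁻¹ := (mem_irrLine.1 hp).1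
    have hh : halfTurn m q.1 ^ (2 * m) = 1 := by
      rw [mul_comm, pow_mul, halfTurn_pow_self hm, ← pow_mul, mul_comm, pow_mul]
      simp
    -- On the line `t^n` is `λ` or `λ⁻¹`, a `2m`-th root of unity.
    have h1 : t ^ (2 * (m * n)) = 1 := by
      rw [show 2 * (m * n) = n * (2 * m) by ring, pow_mul]
      rcases (add_inv_eq_add_inv (pow_ne_zero _ ht) (halfTurn_ne_zero _ _)).1 h0 with h | h
      · rw [h, hh]
      · rw [h, inv_pow, hh, inv_one]
    obtain ⟨l, hl, hlt⟩ := exists_halfTurn_of_pow_eq_one (Nat.mul_pos hm hn) h1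
    have e : diagPoint m n t = diagPoint m n (halfTurn (m * n) l) := by
      rcases hlt with rfl | rfl
      · rfl
      · rw [diagPoint_inv]
    rw [e] at hp ⊢
    exact ⟨l, mem_crossingIndex hq hl ((diagPoint_halfTurn_mem_irrLine hm hn).1 hp),
      crossingPoint_eq m n l⟩
  · rintro ⟨l, hl, rfl⟩
    rw [crossingPoint_eq]
    exact ⟨(diagPoint_halfTurn_mem_irrLine hm hn).2 hl.2,
      (mem_redComponent_iff hmn).2 ⟨_, halfTurn_ne_zero _ _, rfl⟩⟩

theorem injOn_crossingPoint (hm : 0 < m) (hn : 0 < n) (hmn : Nat.Coprime m n) (q : ℕ × ℕ) :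
    Set.InjOn (crossingPoint m n) (crossingIndex m n q) := by
  intro l hl l' hl' h
  obtain ⟨F, hF⟩ := exists_redCurve_parameter hmn
  rw [crossingPoint_eq, crossingPoint_eq, ← curvePoint_redCurve m n (halfTurn_ne_zero _ _),
    ← curvePoint_redCurve m n (halfTurn_ne_zero _ _)] at h
  exact halfTurn_add_inv_injective (Nat.mul_pos hm hn) hl.1.2.le hl'.1.2.le
    (curvePoint_injective hF h)

/-- For coprime `m`, `n` the least common multiple of `2m` and `2n` is `2mn`. -/
theorem modEq_two_mul_mul_iff (hmn : Nat.Coprime m n) {a b : ℤ} :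
    a ≡ b [ZMOD 2 * (m * n : ℕ)] ↔ a ≡ b [ZMOD 2 * m] ∧ a ≡ b [ZMOD 2 * n] := by
  simp only [Int.modEq_iff_dvd]
  constructor
  · intro h
    push_cast at h
    exact ⟨dvd_trans ⟨n, by ring⟩ h, dvd_trans ⟨m, by ring⟩ h⟩
  · rintro ⟨⟨c, hc⟩, h2⟩
    have hc' : b - a = 2 * (m * c) := by rw [hc]; ring
    rw [hc'] at h2 ⊢
    have h3 : (n : ℤ) ∣ m * c := Int.dvd_of_mul_dvd_mul_left (by norm_num) h2
    push_cast
    exact mul_dvd_mul_left 2 (IsCoprime.mul_dvd (Nat.isCoprime_iff_coprime.2 hmn)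
      (dvd_mul_right _ _) h3)

theorem exists_simultaneous_modEq (hmn : Nat.Coprime m n) {a b : ℤ} (hab : a ≡ b [ZMOD 2]) :
    ∃ c : ℤ, c ≡ a [ZMOD 2 * m] ∧ c ≡ b [ZMOD 2 * n] := by
  obtain ⟨d, hd⟩ := hab.dvd
  have hbez : (m : ℤ) * m.gcdA n + n * m.gcdB n = 1 := by
    rw [← Nat.gcd_eq_gcd_ab, hmn, Nat.cast_one]
  -- Here `b - a = 2d`, and `m * m.gcdA n` is `1` mod `n`, so the added term is `0` mod `2m` and
  -- `2d` mod `2n`.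
  refine ⟨a + 2 * (m * (m.gcdA n * d)), ?_, ?_⟩
  · exact (Int.modEq_iff_dvd.2 ⟨-(m.gcdA n * d), by ring⟩)
  · exact (Int.modEq_iff_dvd.2 ⟨m.gcdB n * d, by linear_combination hd - 2 * d * hbez⟩)

/-- The four sign choices give the classes `±a`, `±b` mod `2mn`, where `a` solves `(k, k')` and `b`
solves `(k, -k')`. Up to sign there are two, each with one representative in `[0, mn]`. -/
theorem ncard_crossingIndex (hm : 0 < m) (hn : 0 < n) (hmn : Nat.Coprime m n) {q : ℕ × ℕ}
    (hq : q ∈ lineIndex m n) : (crossingIndex m n q).ncard = 2 := by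
  obtain ⟨⟨hk0, hkm⟩, ⟨hk0', hkn⟩, hpar⟩ := id hq
  have hpar1 : (q.1 : ℤ) ≡ q.2 [ZMOD 2] := (Int.natCast_modEq_iff (n := 2)).2 hpar
  have hpar2 : (q.1 : ℤ) ≡ -q.2 [ZMOD 2] := hpar1.trans (Int.modEq_iff_dvd.2 ⟨-q.2, by ring⟩)
  obtain ⟨a, ha, ha'⟩ := exists_simultaneous_modEq hmn hpar1
  obtain ⟨b, hb, hb'⟩ := exists_simultaneous_modEq hmn hpar2
  have hpos := Nat.mul_pos hm hn
  obtain ⟨l, hl, hal⟩ := exists_le_modEq hpos a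
  obtain ⟨r, hr, hbr⟩ := exists_le_modEq hpos b
  have hnegl : ∀ {N x y : ℤ}, x ≡ -y [ZMOD N] → y ≡ -x [ZMOD N] := fun h => by
    have := h.neg.symm
    rwa [neg_neg] at this
  have hneg : ∀ {N x y : ℤ}, x ≡ y [ZMOD N] ∨ x ≡ -y [ZMOD N] →
      y ≡ x [ZMOD N] ∨ y ≡ -x [ZMOD N] :=
    fun h => h.imp Int.ModEq.symm hnegl
  have htrans : ∀ {N x y z : ℤ}, (x ≡ y [ZMOD N] ∨ x ≡ -y [ZMOD N]) →
      (y ≡ z [ZMOD N] ∨ y ≡ -z [ZMOD N]) → (x ≡ z [ZMOD N] ∨ x ≡ -z [ZMOD N]) := by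
    rintro N x y z (h | h) (h' | h')
    · exact Or.inl (h.trans h')
    · exact Or.inr (h.trans h')
    · exact Or.inr (h.trans h'.neg)
    · exact Or.inl (by simpa using h.trans h'.neg)
  have hred : ∀ {x y : ℤ}, x ≡ y [ZMOD 2 * (m * n : ℕ)] ∨ x ≡ -y [ZMOD 2 * (m * n : ℕ)] →
      (x ≡ y [ZMOD 2 * m] ∨ x ≡ -y [ZMOD 2 * m]) ∧ (x ≡ y [ZMOD 2 * n] ∨ x ≡ -y [ZMOD 2 * n]) := by
    rintro x y (h | h)
    · exact ⟨Or.inl ((modEq_two_mul_mul_iff hmn).1 h).1, Or.inl ((modEq_two_mul_mul_iff hmn).1 h).2⟩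
    · exact ⟨Or.inr ((modEq_two_mul_mul_iff hmn).1 h).1, Or.inr ((modEq_two_mul_mul_iff hmn).1 h).2⟩
  have hlmem : l ∈ crossingIndex m n q := mem_crossingIndex hq hl
    ⟨htrans (hneg (hred hal).1) (Or.inl ha), htrans (hneg (hred hal).2) (Or.inl ha')⟩
  have hrmem : r ∈ crossingIndex m n q := mem_crossingIndex hq hr
    ⟨htrans (hneg (hred hbr).1) (Or.inl hb), htrans (hneg (hred hbr).2) (Or.inr hb')⟩
  have hself : ∀ {N k : ℕ}, 0 < k → k < N → ¬ (k : ℤ) ≡ -k [ZMOD 2 * N] := by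
    intro N k h1 h2 h
    obtain ⟨c, hc⟩ := h.dvd
    have h' : (N : ℤ) ∣ k := ⟨-c, by linarith⟩
    exact (Nat.le_of_dvd h1 (Int.natCast_dvd_natCast.1 h')).not_gt h2
  rw [Set.ncard_eq_two]
  refine ⟨l, r, ?_, ?_⟩
  · rintro rfl
    -- If `a ≡ b` then `k' ≡ -k'` mod `2n`; if `a ≡ -b` then `k ≡ -k` mod `2m`. Both are impossible
    -- in the given ranges.
    rcases htrans hal (hneg hbr) with h | h
    · refine hself hk0' hkn (ha'.symm.trans ?_)
      exact ((modEq_two_mul_mul_iff hmn).1 h).2.trans hb'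
    · refine hself hk0 hkm (ha.symm.trans ?_)
      exact ((modEq_two_mul_mul_iff hmn).1 h).1.trans hb.neg
  · apply Set.Subset.antisymm
    · intro j hj
      have hjle := hj.1.2.le
      have key : ((j : ℤ) ≡ a [ZMOD 2 * (m * n : ℕ)] ∨ (j : ℤ) ≡ -a [ZMOD 2 * (m * n : ℕ)]) ∨
          ((j : ℤ) ≡ b [ZMOD 2 * (m * n : ℕ)] ∨ (j : ℤ) ≡ -b [ZMOD 2 * (m * n : ℕ)]) := by
        simp only [modEq_two_mul_mul_iff hmn]
        obtain ⟨-, h1 | h1, h2 | h2⟩ := hj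
        · exact Or.inl (Or.inl ⟨h1.trans ha.symm, h2.trans ha'.symm⟩)
        · exact Or.inr (Or.inl ⟨h1.trans hb.symm, h2.trans hb'.symm⟩)
        · refine Or.inr (Or.inr ⟨h1.trans hb.symm.neg, h2.trans ?_⟩)
          simpa using hb'.symm.neg
        · exact Or.inl (Or.inr ⟨h1.trans ha.symm.neg, h2.trans ha'.symm.neg⟩)
      rcases key with h | h
      · exact Or.inl (eq_of_modEq_or_modEq_neg hjle hl (htrans h hal))
      · exact Or.inr (eq_of_modEq_or_modEq_neg hjle hr (htrans h hbr))
    · rintro j (rfl | rfl)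
      · exact hlmem
      · exact hrmem

theorem ncard_irrLine_inter_redComponent (hm : 0 < m) (hn : 0 < n) (hmn : Nat.Coprime m n)
    {q : ℕ × ℕ} (hq : q ∈ lineIndex m n) : (irrLine m n q ∩ redComponent m n).ncard = 2 := by
  rw [irrLine_inter_redComponent hm hn hmn hq,
    (injOn_crossingPoint hm hn hmn q).ncard_image, ncard_crossingIndex hm hn hmn hq]

/-! ### The components of the character variety -/

section Components

variable {m n : ℕ}

theorem infinite_irrLine (m n : ℕ) (q : ℕ × ℕ) : (irrLine m n q).Infinite := by
  rw [irrLine_eq_range]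
  exact infinite_range_curvePoint (aeval_verticalLine _ _)

theorem infinite_redComponent (hmn : Nat.Coprime m n) : (redComponent m n).Infinite := by
  obtain ⟨F, hF⟩ := exists_redCurve_parameter hmn
  rw [redComponent_eq_range hmn]
  exact infinite_range_curvePoint hF

theorem finite_irrLine_inter_redComponent (hm : 0 < m) (hn : 0 < n) (hmn : Nat.Coprime m n)
    {q : ℕ × ℕ} (hq : q ∈ lineIndex m n) : (irrLine m n q ∩ redComponent m n).Finite :=
  Set.finite_of_ncard_pos (by rw [ncard_irrLine_inter_redComponent hm hn hmn hq]; norm_num)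

theorem not_irrLine_subset_redComponent (hm : 0 < m) (hn : 0 < n) (hmn : Nat.Coprime m n)
    {q : ℕ × ℕ} (hq : q ∈ lineIndex m n) : ¬ irrLine m n q ⊆ redComponent m n := fun h =>
  infinite_irrLine m n q
    ((finite_irrLine_inter_redComponent hm hn hmn hq).subset (Set.subset_inter subset_rfl h))

theorem not_redComponent_subset_irrLine (hm : 0 < m) (hn : 0 < n) (hmn : Nat.Coprime m n)
    {q : ℕ × ℕ} (hq : q ∈ lineIndex m n) : ¬ redComponent m n ⊆ irrLine m n q := fun h =>
  infinite_redComponent hmn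
    ((finite_irrLine_inter_redComponent hm hn hmn hq).subset (Set.subset_inter h subset_rfl))

theorem redComponent_notMem_image_irrLine (hm : 0 < m) (hn : 0 < n) (hmn : Nat.Coprime m n) :
    redComponent m n ∉ irrLine m n '' lineIndex m n := by
  rintro ⟨q, hq, h⟩
  exact not_redComponent_subset_irrLine hm hn hmn hq h.ge

theorem traceImage_eq_sUnion (hm : 0 < m) (hn : 0 < n) :
    traceImage m n = ⋃₀ insert (redComponent m n) (irrLine m n '' lineIndex m n) := by
  rw [Set.sUnion_insert, Set.sUnion_image]
  apply Set.Subset.antisymm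
  · intro p hp
    obtain ⟨ρ, rfl⟩ := mem_traceImage.1 hp
    by_cases hρ : IsReducible ρ
    · exact Or.inl (mem_redComponent.2 ⟨ρ, hρ, rfl⟩)
    · obtain ⟨q, hq, h⟩ := exists_mem_irrLine_of_irreducible hm hn hρ
      exact Or.inr (Set.mem_biUnion hq h)
  · refine Set.union_subset ?_ (Set.iUnion₂_subset fun q hq => irrLine_subset_traceImage hq)
    rintro _ ⟨χ, -, rfl⟩
    exact ⟨χ, rfl⟩

/-- Every component is a polynomially embedded line. -/
theorem exists_eq_range_curvePoint (hmn : Nat.Coprime m n) {Z : Set (Aff 3)}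
    (hZ : Z ∈ insert (redComponent m n) (irrLine m n '' lineIndex m n)) :
    ∃ (γ : Fin 3 → Polynomial ℂ) (F : MvPolynomial (Fin 3) ℂ),
      aeval γ F = Polynomial.X ∧ Z = Set.range (curvePoint γ) := by
  rcases hZ with rfl | ⟨q, -, rfl⟩
  · obtain ⟨F, hF⟩ := exists_redCurve_parameter hmn
    exact ⟨_, F, hF, redComponent_eq_range hmn⟩
  · exact ⟨_, _, aeval_verticalLine _ _, irrLine_eq_range m n q⟩

theorem isIrreducible_of_mem (hmn : Nat.Coprime m n) {Z : Set (Aff 3)}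
    (hZ : Z ∈ insert (redComponent m n) (irrLine m n '' lineIndex m n)) :
    IsIrreducibleAlgebraicSet Z := by
  obtain ⟨γ, F, hF, rfl⟩ := exists_eq_range_curvePoint hmn hZ
  exact isIrreducible_range_curvePoint hF

theorem components_traceImage (hm : 0 < m) (hn : 0 < n) (hmn : Nat.Coprime m n) :
    components (traceImage m n) = insert (redComponent m n) (irrLine m n '' lineIndex m n) := by
  rw [traceImage_eq_sUnion hm hn]
  refine components_sUnion (((finite_lineIndex m n).image _).insert _)
    (fun Z hZ => isIrreducible_of_mem hmn hZ) ?_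
  rintro _ (rfl | ⟨q, hq, rfl⟩) _ (rfl | ⟨q', hq', rfl⟩) h
  · rfl
  · exact absurd h (not_redComponent_subset_irrLine hm hn hmn hq')
  · exact absurd h (not_irrLine_subset_redComponent hm hn hmn hq)
  · by_contra hne
    have := disjoint_irrLine hq hq' fun e => hne (by rw [e])
    obtain ⟨p, hp⟩ := irrLine_nonempty m n q
    exact Set.disjoint_left.1 this hp (h hp)

theorem isCurve_traceImage (hm : 0 < m) (hn : 0 < n) (hmn : Nat.Coprime m n) :
    IsCurve (traceImage m n) := by
  refine ⟨?_, ?_, fun Z hZ => ?_⟩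
  · rw [traceImage_eq_sUnion hm hn]
    exact isAlgebraicSet_sUnion (((finite_lineIndex m n).image _).insert _)
      fun Z hZ => (isIrreducible_of_mem hmn hZ).1
  · rw [traceImage_eq_sUnion hm hn, Set.sUnion_insert]
    exact (infinite_redComponent hmn).nonempty.inl
  · rw [components_traceImage hm hn hmn] at hZ
    obtain ⟨γ, F, hF, rfl⟩ := exists_eq_range_curvePoint hmn hZ
    exact dimension_range_curvePoint hF

theorem ncard_components (hm : 0 < m) (hn : 0 < n) (hmn : Nat.Coprime m n) :
    (components (traceImage m n)).ncard = (m - 1) * (n - 1) / 2 + 1 := by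
  rw [components_traceImage hm hn hmn,
    Set.ncard_insert_of_notMem (redComponent_notMem_image_irrLine hm hn hmn)
      ((finite_lineIndex m n).image _),
    (injOn_irrLine m n).ncard_image, ncard_lineIndex hmn]

theorem irrLine_diff_redComponent_subset {q : ℕ × ℕ} (hq : q ∈ lineIndex m n) :
    irrLine m n q \ redComponent m n ⊆
      traceMap m n '' irreducibleCharacters (TorusKnotGroup m n) := by
  rintro p ⟨hp, hp'⟩
  obtain ⟨ρ, rfl⟩ := mem_traceImage.1 (irrLine_subset_traceImage hq hp)
  exact mem_image_irreducibleCharacters.2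
    ⟨ρ, fun hρ => hp' (mem_redComponent.2 ⟨ρ, hρ, rfl⟩), rfl⟩

/-- A line loses only finitely many points to the reducible curve, and the others come from
irreducible characters. A polynomial vanishing at those has infinitely many zeros on the line, hence
vanishes on all of it. -/
theorem zariskiClosure_irreducibleCharacters (hm : 0 < m) (hn : 0 < n) (hmn : Nat.Coprime m n) :
    zariskiClosure (traceMap m n '' irreducibleCharacters (TorusKnotGroup m n)) =
      ⋃ q ∈ lineIndex m n, irrLine m n q := by
  apply Set.Subset.antisymm
  · have halg : IsAlgebraicSet (⋃ q ∈ lineIndex m n, irrLine m n q) := by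
      rw [← Set.sUnion_image]
      exact isAlgebraicSet_sUnion ((finite_lineIndex m n).image _)
        fun Z hZ => (isIrreducible_of_mem hmn (Or.inr hZ)).1
    intro p hp
    refine isAlgebraicSet_iff.1 halg p fun f hf => ?_
    rw [← aeval_eq_eval]
    refine hp f (vanishingIdeal_anti_mono ?_ hf)
    intro p' hp'
    obtain ⟨ρ, hρ, rfl⟩ := mem_image_irreducibleCharacters.1 hp'
    obtain ⟨q, hq, h⟩ := exists_mem_irrLine_of_irreducible hm hn hρ
    exact Set.mem_biUnion hq h
  · refine Set.iUnion₂_subset fun q hq p hp f hf => ?_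
    rw [aeval_eq_eval]
    rw [mem_vanishingIdeal_iff_eval] at hf
    have hfin := finite_irrLine_inter_redComponent hm hn hmn hq
    have hdiff := irrLine_diff_redComponent_subset hq
    rw [irrLine_eq_range] at hp hfin hdiff
    obtain ⟨s, rfl⟩ := hp
    set γ := verticalLine (halfTurn m q.1 + (halfTurn m q.1)⁻¹)
      (halfTurn n q.2 + (halfTurn n q.2)⁻¹)
    have hinj : Function.Injective (curvePoint γ) := curvePoint_injective (aeval_verticalLine _ _)
    have h0 : aeval γ f = 0 := by
      apply Polynomial.eq_zero_of_infinite_isRoot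
      have hpre := hfin.preimage hinj.injOn
      refine hpre.infinite_compl.mono fun r hr => ?_
      have hr' : curvePoint γ r ∉ redComponent m n := fun h => hr ⟨⟨r, rfl⟩, h⟩
      have := hf _ (hdiff ⟨⟨r, rfl⟩, hr'⟩)
      rwa [eval_curvePoint] at this
    rw [eval_curvePoint, h0, Polynomial.eval_zero]

/-! ### Nodes -/

/-- With `s = t + t⁻¹`, a zero of the derivative forces `t^k = ±1`, whereas `t^k` is `u` or `u⁻¹`.
At a crossing this says that the reducible curve is not vertical. -/
theorem derivative_chebyshev_C_ne_zero {k : ℕ} (hk : 0 < k) {s u : ℂ} (hu : u ≠ 0)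
    (hu2 : u ^ 2 ≠ 1) (h : (Polynomial.Chebyshev.C ℂ k).eval s = u + u⁻¹) :
    (Polynomial.Chebyshev.C ℂ k).derivative.eval s ≠ 0 := by
  obtain ⟨t, ht, rfl⟩ := exists_add_inv_eq s
  have htk := pow_ne_zero k ht
  rw [eval_chebyshev_C ht, add_inv_eq_add_inv htk hu] at h
  intro h0
  have h1 := derivative_chebyshev_C ht k
  rw [h0, zero_mul, eq_comm, mul_eq_zero, or_iff_right (Nat.cast_ne_zero.2 hk.ne')] at h1
  apply hu2
  have h2 : (t ^ k) ^ 2 = 1 := by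
    have := mul_inv_cancel₀ htk
    linear_combination t ^ k * h1 + this
  rcases h with h | h
  · rw [← h, h2]
  · rw [← inv_inv u, ← h, inv_pow, h2, inv_one]

theorem isNodalCrossing_of_mem (hm : 0 < m) (hn : 0 < n) (hmn : Nat.Coprime m n) {q : ℕ × ℕ}
    (hq : q ∈ lineIndex m n) {p : Aff 3} (hp : p ∈ irrLine m n q) (hp' : p ∈ redComponent m n) :
    IsNodalCrossing (traceImage m n) p := by
  obtain ⟨F, hF⟩ := exists_redCurve_parameter hmn
  have hS := components_traceImage hm hn hmn
  rw [redComponent_eq_range hmn] at hp'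
  obtain ⟨s, rfl⟩ := hp'
  have hpL := mem_irrLine.1 hp
  have hp2 := hp
  rw [irrLine_eq_range] at hp2
  obtain ⟨z, hz⟩ := hp2
  have hv : (redCurve m n 0).derivative.eval s ≠ 0 :=
    derivative_chebyshev_C_ne_zero hn (halfTurn_ne_zero _ _) (halfTurn_sq_ne_one hq.1.1 hq.1.2)
      hpL.1
  have hpred : curvePoint (redCurve m n) s ∈ redComponent m n := by
    rw [redComponent_eq_range hmn]
    exact ⟨s, rfl⟩
  have hTL : tangentSpace (irrLine m n q) (curvePoint (redCurve m n) s) =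
      Submodule.span ℂ {![0, 0, 1]} := by
    rw [irrLine_eq_range, ← hz, tangentSpace_range_curvePoint (aeval_verticalLine _ _),
      curveVelocity_verticalLine]
  have hTR : tangentSpace (redComponent m n) (curvePoint (redCurve m n) s) =
      Submodule.span ℂ {curveVelocity (redCurve m n) s} := by
    rw [redComponent_eq_range hmn, tangentSpace_range_curvePoint hF]
  have hLmem : irrLine m n q ∈ components (traceImage m n) := hS ▸ Or.inr ⟨q, hq, rfl⟩
  have hRmem : redComponent m n ∈ components (traceImage m n) := hS ▸ Or.inl rfl
  refine ⟨irrLine m n q, hLmem, redComponent m n, hRmem, ?_, ?_, ?_, ?_, ?_, ?_⟩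
  · intro h
    exact redComponent_notMem_image_irrLine hm hn hmn ⟨q, hq, h⟩
  · intro Z hZ
    rw [hS] at hZ
    constructor
    · intro hpZ
      rcases hZ with rfl | ⟨q', hq', rfl⟩
      · exact Or.inr rfl
      · left
        by_contra hne
        exact Set.disjoint_left.1 (disjoint_irrLine hq' hq fun e => hne (by rw [e])) hpZ hp
    · rintro (rfl | rfl)
      · exact hp
      · exact hpred
  · rw [hTL]
    exact finrank_span_singleton fun h => by simpa using congrFun h 2
  · rw [hTR, finrank_span_singleton (curveVelocity_ne_zero hF s)]
  · rw [hTL, hTR, Submodule.eq_bot_iff]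
    rintro w ⟨hw, hw'⟩
    obtain ⟨a, rfl⟩ := Submodule.mem_span_singleton.1 hw
    obtain ⟨b, hb⟩ := Submodule.mem_span_singleton.1 hw'
    have h0 := congrFun hb 0
    have hb0 : b = 0 := by
      simpa [curveVelocity, hv] using h0
    rw [← hb, hb0, zero_smul]
  · apply le_antisymm
    · exact sup_le (tangentSpace_mono hLmem.1.2 _) (tangentSpace_mono hRmem.1.2 _)
    · rw [hTL, hTR]
      -- The remaining lines miss the point by disjointness, so they play the part of `W` in
      -- `tangentSpace_crossing`.
      have hW : IsAlgebraicSet (⋃₀ (irrLine m n '' (lineIndex m n \ {q}))) := by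
        refine isAlgebraicSet_sUnion (((finite_lineIndex m n).subset Set.sdiff_subset).image _) ?_
        rintro _ ⟨q', hq', rfl⟩
        exact (isIrreducible_of_mem hmn (Or.inr ⟨q', hq'.1, rfl⟩)).1
      have hpW : curvePoint (redCurve m n) s ∉ ⋃₀ (irrLine m n '' (lineIndex m n \ {q})) := by
        rintro ⟨_, ⟨q', hq', rfl⟩, h⟩
        exact Set.disjoint_left.1 (disjoint_irrLine hq'.1 hq hq'.2) h hp
      refine le_trans (tangentSpace_mono ?_ _) (tangentSpace_crossing hF hpL.1 hpL.2 hv hW hpW)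
      rw [← irrLine_eq_range, ← redComponent_eq_range hmn, traceImage_eq_sUnion hm hn]
      refine Set.sUnion_subset ?_
      rintro _ (rfl | ⟨q', hq', rfl⟩)
      · exact fun _ h => Or.inl (Or.inr h)
      · by_cases e : q' = q
        · subst e
          exact fun _ h => Or.inl (Or.inl h)
        · exact fun _ h => Or.inr ⟨_, ⟨q', ⟨hq', e⟩, rfl⟩, h⟩

theorem isNodalCrossing_traceImage (hm : 0 < m) (hn : 0 < n) (hmn : Nat.Coprime m n)
    {Z₁ Z₂ : Set (Aff 3)} (h₁ : Z₁ ∈ components (traceImage m n))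
    (h₂ : Z₂ ∈ components (traceImage m n)) (hne : Z₁ ≠ Z₂) {p : Aff 3} (hp : p ∈ Z₁ ∩ Z₂) :
    IsNodalCrossing (traceImage m n) p := by
  rw [components_traceImage hm hn hmn] at h₁ h₂
  rcases h₁ with rfl | ⟨q, hq, rfl⟩ <;> rcases h₂ with rfl | ⟨q', hq', rfl⟩
  · exact absurd rfl hne
  · exact isNodalCrossing_of_mem hm hn hmn hq' hp.2 hp.1
  · exact isNodalCrossing_of_mem hm hn hmn hq hp.1 hp.2
  · exact absurd hp.2 (Set.disjoint_left.1 (disjoint_irrLine hq hq' fun e => hne (by rw [e])) hp.1)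

end Components

end TorusKnotChar
open TorusKnotChar in
theorem theorem1 (m n : ℕ) (hm : 0 < m) (hn : 0 < n) (hmn : Nat.Coprime m n) :
    -- `C` is a curve, and `Ψ` is an isomorphism of the character variety with `C`
    (IsCurve (traceImage m n) ∧
      IsIsomorphism (charFunctions (TorusKnotGroup m n)) (regularFunctions (traceImage m n))
        (Set.rangeFactorization (traceMap m n))) ∧
    -- the number of components; they are smooth and isomorphic to `ℂ`
    (components (traceImage m n)).ncard = (m - 1) * (n - 1) / 2 + 1 ∧
    (∀ Z ∈ components (traceImage m n),
      IsSmooth Z ∧ ∃ φ : Z → ℂ, IsIsomorphism (regularFunctions Z) lineFunctions φ) ∧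
    -- the components meet only in nodes
    (∀ Z₁ ∈ components (traceImage m n), ∀ Z₂ ∈ components (traceImage m n), Z₁ ≠ Z₂ →
      ∀ p ∈ Z₁ ∩ Z₂, IsNodalCrossing (traceImage m n) p) ∧
    -- one component consists of the reducible characters, the others are lines, which
    -- together form the closure of the set of irreducible characters
    redComponent m n ∈ components (traceImage m n) ∧
    components (traceImage m n) \ {redComponent m n} = irrLine m n '' lineIndex m n ∧
    Set.InjOn (irrLine m n) (lineIndex m n) ∧
    zariskiClosure (traceMap m n '' irreducibleCharacters (TorusKnotGroup m n)) =
      ⋃ q ∈ lineIndex m n, irrLine m n q ∧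
    -- different lines are disjoint
    (∀ q ∈ lineIndex m n, ∀ q' ∈ lineIndex m n, q ≠ q' →
      Disjoint (irrLine m n q) (irrLine m n q')) ∧
    -- each line meets the reducible component in two points
    (∀ q ∈ lineIndex m n,
      (irrLine m n q ∩ redComponent m n).ncard = 2 ∧
      irrLine m n q ∩ redComponent m n = crossingPoint m n '' crossingIndex m n q) := by

  have hC := components_traceImage hm hn hmn
  refine ⟨⟨isCurve_traceImage hm hn hmn, isIsomorphism_traceMap m n⟩, ncard_components hm hn hmn,
    ?_, fun _ h₁ _ h₂ hne _ hp => isNodalCrossing_traceImage hm hn hmn h₁ h₂ hne hp, ?_, ?_,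
    injOn_irrLine m n, zariskiClosure_irreducibleCharacters hm hn hmn,
    fun _ hq _ hq' h => disjoint_irrLine hq hq' h,
    fun _ hq => ⟨ncard_irrLine_inter_redComponent hm hn hmn hq,
      irrLine_inter_redComponent hm hn hmn hq⟩⟩
  · intro Z hZ
    rw [hC] at hZ
    obtain ⟨γ, F, hF, rfl⟩ := exists_eq_range_curvePoint hmn hZ
    exact ⟨isSmooth_range_curvePoint hF, _, isIsomorphism_parameter hF⟩
  · rw [hC]
    exact Set.mem_insert _ _
  · rw [hC]
    exact Set.insert_sdiff_self_of_notMem (redComponent_notMem_image_irrLine hm hn hmn)
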